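/- Let $\{\xi_k\}_{k\in\mathbb Z}$ and $\{\eta_k\}_{k\in\mathbb Z}$ be mutually independent, centred, (second-order) stationary complex random sequences with absolutely continuous spectral measures and spectral densities $f>0$, $g>0$ on $(-\pi,\pi]$, i.e. $f,g$ are integrable and $E\,\xi_n\overline{\xi_m}=\frac1{2\pi}\int_{-\pi}^{\pi}e^{i(n-m)\theta}f(\theta)\,d\theta$, and similarly for $\eta$ with $g$. Assume the minimality condition $$\int_{-\pi}^{\pi}\frac{d\theta}{f(\theta)+g(\theta)}<\infty .$$ Let $a=(a_0,a_1,\dots)$ be complex numbers with $\sum_j|a_j|<\infty$ and $\sum_j(j+1)|a_j|^2<\infty$, and put $A(e^{i\theta})=\sum_{j\ge0}a_je^{ij\theta}$ and $A\xi=\sum_{j\ge0}a_j\xi_j$ (convergent in mean square). Let $\mathbf B,\mathbf R,\mathbf Q$ be the operators given by the Toeplitz matrices whose $(k,j)$ entries, $k,j\ge0$, are $\frac1{2\pi}\int_{-\pi}^{\pi}e^{i(j-k)\theta}s(\theta)\,d\theta$ with $s=\frac1{f+g}$, $s=\frac f{f+g}$, $s=\frac{fg}{f+g}$ respectively. Let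 $\hat A\xi$ be the optimal linear estimate of $A\xi$ from the observations $\xi_k+\eta_k$, $k=-1,-2,\dots$, i.e. the orthogonal projection of $A\xi$ onto the closed linear span of these observations in mean square. The operator $\mathbf B$ need not be bounded on $\ell_2$ or boundedly invertible there, and $\mathbf B^{-1}$ is understood as follows: $c=\mathbf B^{-1}\mathbf Ra$ and $e=\langle\mathbf Ra,\mathbf B^{-1}\mathbf Ra\rangle$ mean that there are finitely supported sequences $x^{(n)}$, Cauchy in the norm $\langle\mathbf Bx,x\rangle^{1/2}$, such that $\mathbf Bx^{(n)}\to\mathbf Ra$ and $x^{(n)}\to c$ coordinatewise and $\langle\mathbf Ra,x^{(n)}\rangle\to e$. The sum $\sum_{j\ge0}c_je^{ij\theta}$ denotes the integrable function whose Fourier coefficients are $c_j$ for $j\ge0$ and $0$ for $j<0$. Then $\mathbf Ra\in\ell_2$; $c=\mathbf B^{-1}\mathbf Ra$ and $e=\langle\mathbf Ra,\mathbf B^{-1}\mathbf Ra\rangle$ exist and are unique; the function $C(\theta)=\sum_{j\ge0}(\mathbf B^{-1}\mathbf Ra)_je^{ij\theta}$ exists and is unique up to null sets; and: 1. $\hat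 A\xi=\int_{-\pi}^{\pi}h(\theta)\,\bigl(dZ^{\xi}(\theta)+dZ^{\eta}(\theta)\bigr)$, where $Z^\xi,Z^\eta$ are the random spectral measures of $\xi,\eta$ (that is, $\hat A\xi$ corresponds to $h$ under the isomorphism $e^{ik\theta}\leftrightarrow\xi_k+\eta_k$ of $L^2(f+g)$ onto the closed linear span of all $\xi_k+\eta_k$), and the spectral characteristic $h$, which is unique up to null sets and belongs to the closed span of $\{e^{ik\theta}:k\le-1\}$ in $L^2(f+g)$, is $$h(\theta)=\frac{A(e^{i\theta})f(\theta)-\sum_{j\ge0}(\mathbf B^{-1}\mathbf Ra)_je^{ij\theta}}{f(\theta)+g(\theta)}=A(e^{i\theta})-\frac{A(e^{i\theta})g(\theta)+\sum_{j\ge0}(\mathbf B^{-1}\mathbf Ra)_je^{ij\theta}}{f(\theta)+g(\theta)}.$$ 2. The mean square error is $$E|A\xi-\hat A\xi|^2=\frac1{2\pi}\int_{-\pi}^{\pi}\frac{|A(e^{i\theta})g(\theta)+C(\theta)|^2}{(f(\theta)+g(\theta))^2}f(\theta)\,d\theta+\frac1{2\pi}\int_{-\pi}^{\pi}\frac{|A(e^{i\theta})f(\theta)-C(\theta)|^2}{(f(\theta)+g(\theta))^2}g(\theta)\,d\theta=\langle\mathbf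 Ra,\mathbf B^{-1}\mathbf Ra\rangle+\langle\mathbf Qa,a\rangle .$$ 3. These notions agree with those of $\ell_2$ where the latter apply: if $\mathbf B$ is bounded on $\ell_2$ and $x\in\ell_2$ satisfies $\mathbf Bx=\mathbf Ra$, then $c=x$; if $f+g$ is essentially bounded, then $c\in\ell_2$; and if $c\in\ell_2$, then $e=\sum_k(\mathbf Ra)_k\overline{c_k}$ and the series $\sum_jc_je^{ij\theta}$ converges to $C$ in $L^2(-\pi,\pi)$. -/

import Mathlib

open MeasureTheory ProbabilityTheory Filter Topology
open scoped ComplexConjugate ENNReal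

noncomputable section

namespace Extrapolation

/-- Lebesgue measure on `(-π, π]`. -/
def circ : Measure ℝ := volume.restrict (Set.Ioc (-Real.pi) Real.pi)

/-- The exponential `e^{ikθ}`. -/
def ex (k : ℤ) (θ : ℝ) : ℂ := Complex.exp (Complex.I * (k : ℂ) * (θ : ℂ))

/-- The normalized integral `(1/2π) ∫_{-π}^{π} φ(θ) dθ`. -/
def mean (φ : ℝ → ℂ) : ℂ := ((1 / (2 * Real.pi) : ℝ) : ℂ) * ∫ θ, φ θ ∂circ

/-- The `k`-th Fourier coefficient `(1/2π) ∫ φ(θ) e^{-ikθ} dθ`. -/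
def fourierCoef (φ : ℝ → ℂ) (k : ℤ) : ℂ := mean fun θ => φ θ * ex (-k) θ

/-- The trigonometric polynomial `∑_k p_k e^{ikθ}`. -/
def trigPoly (p : ℤ →₀ ℂ) (θ : ℝ) : ℂ := p.sum fun k z => z * ex k θ

/-- `∫_{-π}^{π} |φ(θ)|² w(θ) dθ`, as an extended nonnegative number. -/
def sqDist (w : ℝ → ℝ) (φ : ℝ → ℂ) : ℝ≥0∞ :=
  ∫⁻ θ, ‖φ θ‖ₑ ^ 2 * ENNReal.ofReal (w θ) ∂circ

/-- `h` belongs to the closed linear span in `L²(w)` of the `e^{ikθ}`, `k ∈ S`. -/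
def MemClosedSpan (S : Set ℤ) (w : ℝ → ℝ) (h : ℝ → ℂ) : Prop :=
  AEStronglyMeasurable h circ ∧
    ∃ p : ℕ → (ℤ →₀ ℂ), (∀ n, ∀ k ∈ (p n).support, k ∈ S) ∧
      Tendsto (fun n => sqDist w fun θ => h θ - trigPoly (p n) θ) atTop (𝓝 0)

section Probability

variable {Ω : Type*} [MeasurableSpace Ω]

/-- `ξ` is a centred (second order) stationary random sequence whose spectral measure is
absolutely continuous with spectral density `f` (with respect to `dθ / 2π`). -/
structure IsStationary (P : Measure Ω) (ξ : ℤ → Ω → ℂ) (f : ℝ → ℝ) : Prop where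
  memLp : ∀ k, MemLp (ξ k) 2 P
  centred : ∀ k, ∫ ω, ξ k ω ∂P = 0
  integrable : Integrable f circ
  nonneg : ∀ᵐ θ ∂circ, 0 ≤ f θ
  cov : ∀ n m : ℤ, ∫ ω, ξ n ω * conj (ξ m ω) ∂P = mean fun θ => ex (n - m) θ * (f θ : ℂ)

/-- The `k`-th value of the sequence as an element of `L²(P)`. -/
def IsStationary.toL2 {P : Measure Ω} {ξ : ℤ → Ω → ℂ} {f : ℝ → ℝ}
    (h : IsStationary P ξ f) (k : ℤ) : Lp ℂ 2 P := (h.memLp k).toLp (ξ k)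

/-- `X = ∫ h(θ) dZ(θ)`, where `Z` is the random spectral measure of the stationary sequence `ζ`
with spectral density `w`: `X` corresponds to `h` under the isomorphism `e^{ikθ} ↔ ζ_k` between
`L²(w)` and the closed linear span of the `ζ_k`, extended by continuity from trigonometric
polynomials. -/
def IsSpectralIntegral {P : Measure Ω} (ζ : ℤ → Lp ℂ 2 P) (w : ℝ → ℝ) (h : ℝ → ℂ)
    (X : Lp ℂ 2 P) : Prop :=
  AEStronglyMeasurable h circ ∧
    ∃ p : ℕ → (ℤ →₀ ℂ),
      Tendsto (fun n => sqDist w fun θ => h θ - trigPoly (p n) θ) atTop (𝓝 0) ∧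
      Tendsto (fun n => (p n).sum fun k z => z • ζ k) atTop (𝓝 X)

/-- The closed linear manifold in `L²(P)` generated by the `ζ_k`, `k = -1, -2, …`. -/
def past {P : Measure Ω} (ζ : ℤ → Lp ℂ 2 P) : Submodule ℂ (Lp ℂ 2 P) :=
  (Submodule.span ℂ (ζ '' Set.Iio 0)).topologicalClosure

instance {P : Measure Ω} (ζ : ℤ → Lp ℂ 2 P) : CompleteSpace (past ζ) :=
  (Submodule.isClosed_topologicalClosure _).completeSpace_coe

/-- The optimal linear estimate of `X` from the `ζ_k`, `k = -1, -2, …`: the orthogonal projection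
of `X` onto `past ζ`. -/
def optimalEstimate {P : Measure Ω} (ζ : ℤ → Lp ℂ 2 P) (X : Lp ℂ 2 P) : Lp ℂ 2 P :=
  (past ζ).starProjection X

end Probability

/-- The symbol `A(e^{iθ}) = ∑_{j ≥ 0} a_j e^{ijθ}` of an absolutely summable sequence. -/
def symbolA (a : ℕ → ℂ) (θ : ℝ) : ℂ := ∑' j : ℕ, a j * ex j θ

/-- The Toeplitz matrix with entries `(1/2π) ∫ e^{i(j-k)θ} s(θ) dθ`, `k, j = 0, 1, 2, …`. -/
def toeplitz (s : ℝ → ℝ) (k j : ℕ) : ℂ := mean fun θ => ex ((j : ℤ) - k) θ * (s θ : ℂ)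

/-- The image `M x` of a sequence `x`, `(M x)_k = ∑_j M_{kj} x_j`. -/
def matVec (M : ℕ → ℕ → ℂ) (x : ℕ → ℂ) (k : ℕ) : ℂ := ∑' j, M k j * x j

/-- The inner product `⟨y, x⟩ = ∑_k y_k \bar{x_k}`. -/
def pairing (y x : ℕ → ℂ) : ℂ := ∑' k, y k * conj (x k)

/-- `c = M⁻¹ y` and `e = ⟨y, M⁻¹ y⟩` for a positive definite matrix `M` that need not be bounded
on `ℓ₂` or boundedly invertible there. The matrix operator, defined on finite sequences, is
extended by continuity to the completion in its energy norm `⟨M x, x⟩^{1/2}`: there are finite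
sequences `x⁽ⁿ⁾`, Cauchy in that norm, with `M x⁽ⁿ⁾ → y` and `x⁽ⁿ⁾ → c` coordinatewise and
`⟨y, x⁽ⁿ⁾⟩ → e`. -/
def IsInverse (M : ℕ → ℕ → ℂ) (y c : ℕ → ℂ) (e : ℂ) : Prop :=
  ∃ x : ℕ → (ℕ →₀ ℂ),
    (∀ ε > (0 : ℝ), ∃ N, ∀ m ≥ N, ∀ n ≥ N,
      ‖pairing (matVec M ⇑(x m - x n)) ⇑(x m - x n)‖ < ε) ∧
    (∀ k, Tendsto (fun n => matVec M ⇑(x n) k) atTop (𝓝 (y k))) ∧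
    (∀ j, Tendsto (fun n => x n j) atTop (𝓝 (c j))) ∧
    Tendsto (fun n => pairing y ⇑(x n)) atTop (𝓝 e)

/-- `C(θ) = ∑_{j ≥ 0} c_j e^{ijθ}`, as a Fourier series: `C` is the integrable function with
Fourier coefficients `c_j` for `j ≥ 0` and `0` for `j < 0`. -/
def IsFourierSum (c : ℕ → ℂ) (C : ℝ → ℂ) : Prop :=
  Integrable C circ ∧ (∀ j : ℕ, fourierCoef C j = c j) ∧ ∀ k : ℤ, k < 0 → fourierCoef C k = 0

end Extrapolation

end

noncomputable section

namespace Extrapolation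

/-! ### Exponentials on the circle -/

/-! Put `v = √(f+g)` and `u = 1/v`; both are square integrable, `u` by minimality. Multiplication by
`v` carries `L²(f+g)` into `L²`, and `e^{ikθ}` to `wex v k`. Independence and centring make the Gram
matrix of the observations equal to that of the `wex v k` up to the factor `1/2π`
(`inner_observation`), so the probabilistic projection becomes one in `L²`.

A function `h` is optimal when it lies in the span of the negative frequencies and `C = A f - h
(f+g)` has no negative Fourier coefficients. Multiplied by `u`, this reads `h v = Y - X` with `Y = A
f u` (`target`) and `X = C u`. The natural candidate for `X` is the projection of `Y` onto `wspan u
(Set.Ici 0)`. Now `B` is the normalized Gram matrix of the `wex u k`, `k ≥ 0`, and `R a` is the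
vector of normalized inner products of `Y` with them (`isGram_target`). Thus the energy norm of `B`
is a multiple of the norm of `L²`, and `B⁻¹ R a` consists of the coordinates of `X`, read off by the
biorthogonal family `wex v k` (`IsGram.isInverse`, `IsGram.isInverse_unique`).

It remains to see that `Y - X` lies in `wspan v (Set.Iio 0)`. Biorthogonality only makes that space
orthogonal to `wspan u (Set.Ici 0)`; that the two are orthogonal complements is the analytic core
(`orthogonal_le_wspan`, `wspan_orthogonal_le`). It is proved with Szegő extremal functions:
unimodular `x` and `y` in the analytic spans for `v` and `u` whose product is constant, so that
dividing by `x` reduces the weighted question to the unweighted one.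

The error splits into an `f`-part and a `g`-part by independence (`exists_spectralIntegral`), and
`error_identity` regroups their densities into those of `⟨Ra, B⁻¹Ra⟩ = ‖X‖²/2π` and `⟨Qa, a⟩`. -/

instance isFiniteMeasure_circ : IsFiniteMeasure circ := by
  unfold circ; infer_instance

lemma ex_zero (θ : ℝ) : ex 0 θ = 1 := by simp [ex]

lemma ex_add (j k : ℤ) (θ : ℝ) : ex (j + k) θ = ex j θ * ex k θ := by
  simp only [ex, ← Complex.exp_add]; congr 1; push_cast; ring

lemma conj_ex (k : ℤ) (θ : ℝ) : conj (ex k θ) = ex (-k) θ := by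
  simp [ex, ← Complex.exp_conj]

lemma norm_ex (k : ℤ) (θ : ℝ) : ‖ex k θ‖ = 1 := by
  have : Complex.I * (k : ℂ) * (θ : ℂ) = ((k * θ : ℝ) : ℂ) * Complex.I := by push_cast; ring
  rw [ex, this, Complex.norm_exp_ofReal_mul_I]

lemma continuous_ex (k : ℤ) : Continuous (ex k) := by unfold ex; fun_prop

lemma ex_eq_fourier (k : ℤ) (θ : ℝ) :
    ex k θ = fourier k ((θ : ℝ) : AddCircle (2 * Real.pi)) := by
  rw [fourier_coe_apply, ex]; congr 1; push_cast
  have : (Real.pi : ℂ) ≠ 0 := by exact_mod_cast Real.pi_ne_zero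
  field_simp

lemma integral_circ_eq (φ : ℝ → ℂ) :
    ∫ θ, φ θ ∂circ = ∫ θ in (-Real.pi)..Real.pi, φ θ := by
  rw [intervalIntegral.integral_of_le (by linarith [Real.pi_pos])]; rfl

lemma integral_ex (k : ℤ) : ∫ θ, ex k θ ∂circ = if k = 0 then ((2 * Real.pi : ℝ) : ℂ) else 0 := by
  rw [integral_circ_eq]
  split_ifs with h
  · subst h
    simp only [ex_zero, intervalIntegral.integral_const]
    simp; ring
  · have hk : Complex.I * (k : ℂ) ≠ 0 := mul_ne_zero Complex.I_ne_zero (by exact_mod_cast h)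
    simp only [ex]
    rw [integral_exp_mul_complex hk]
    rw [div_eq_zero_iff]; left
    rw [sub_eq_zero, Complex.exp_eq_exp_iff_exists_int]
    exact ⟨k, by push_cast; ring⟩

/-- Integration against `φ` is a functional on continuous functions on the circle, continuous for
the sup norm. It vanishes on trigonometric polynomials, which are dense, hence on all continuous
functions, in particular on test functions of the open interval. -/
lemma ae_eq_zero_of_integral_ex {φ : ℝ → ℂ} (hφ : Integrable φ circ)
    (h : ∀ k : ℤ, ∫ θ, φ θ * ex k θ ∂circ = 0) : φ =ᵐ[circ] 0 := by
  have : Fact (0 < 2 * Real.pi) := ⟨by positivity⟩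
  have hint (g : C(AddCircle (2 * Real.pi), ℂ)) :
      Integrable (fun θ : ℝ => φ θ * g (θ : AddCircle (2 * Real.pi))) circ := by
    refine hφ.mul_bdd (c := ‖g‖) ?_ (.of_forall fun θ => g.norm_coe_le_norm _)
    exact (g.continuous.comp (AddCircle.continuous_mk' _)).aestronglyMeasurable
  let Λ : C(AddCircle (2 * Real.pi), ℂ) →L[ℂ] ℂ := LinearMap.mkContinuous
    { toFun := fun g => ∫ θ, φ θ * g (θ : AddCircle (2 * Real.pi)) ∂circ
      map_add' := fun g g' => by
        simp only [ContinuousMap.add_apply, mul_add]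
        exact integral_add (hint g) (hint g')
      map_smul' := fun z g => by
        simp only [ContinuousMap.smul_apply, smul_eq_mul, RingHom.id_apply]
        rw [← integral_const_mul]; congr 1; ext θ; ring }
    (∫ θ, ‖φ θ‖ ∂circ) (fun g => by
      rw [← integral_mul_const]
      refine norm_integral_le_of_norm_le (hφ.norm.mul_const _) (.of_forall fun θ => ?_)
      rw [norm_mul]
      exact mul_le_mul_of_nonneg_left (g.norm_coe_le_norm _) (norm_nonneg _))
  have hΛ : ∀ g, Λ g = 0 := by
    have h1 : Submodule.span ℂ (Set.range (@fourier (2 * Real.pi))) ≤ LinearMap.ker Λ.toLinearMap := by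
      rw [Submodule.span_le]
      rintro _ ⟨k, rfl⟩
      have := h k
      simp only [ex_eq_fourier] at this
      exact this
    have h2 := Submodule.topologicalClosure_minimal _ h1 Λ.isClosed_ker
    rw [span_fourier_closure_eq_top] at h2
    exact fun g => h2 (Submodule.mem_top (x := g))
  have hloc : LocallyIntegrableOn φ (Set.Ioo (-Real.pi) Real.pi) volume :=
    (IntegrableOn.mono_set (t := Set.Ioc (-Real.pi) Real.pi) hφ
      Set.Ioo_subset_Ioc_self).locallyIntegrableOn
  have key := isOpen_Ioo.ae_eq_zero_of_integral_contDiff_smul_eq_zero hloc (fun g hg _ hs => by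
    have hz : ∀ x, x ∉ Set.Ioo (-Real.pi) Real.pi → g x = 0 := fun x hx =>
      image_eq_zero_of_notMem_tsupport fun hx' => hx (hs hx')
    -- The test function vanishes at both endpoints, so its periodic extension is continuous.
    have hc : Continuous (AddCircle.liftIoc (2 * Real.pi) (-Real.pi) fun x => (g x : ℂ)) := by
      refine AddCircle.liftIoc_continuous ?_ ?_
      · rw [hz _ (by simp), hz (-Real.pi + 2 * Real.pi) (by rw [Set.mem_Ioo]; intro h; linarith [h.2])]
      · exact (Complex.continuous_ofReal.comp hg.continuous).continuousOn
    have h0 := hΛ ⟨_, hc⟩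
    change ∫ θ, φ θ * AddCircle.liftIoc (2 * Real.pi) (-Real.pi) (fun x => (g x : ℂ)) θ ∂circ = 0
      at h0
    rw [← setIntegral_eq_integral_of_forall_compl_eq_zero (s := Set.Ioc (-Real.pi) Real.pi)
      (fun x hx => by rw [hz x fun h => hx (Set.Ioo_subset_Ioc_self h), zero_smul]), ← h0]
    refine setIntegral_congr_fun measurableSet_Ioc fun x hx => ?_
    have hx' : x ∈ Set.Ioc (-Real.pi) (-Real.pi + 2 * Real.pi) := ⟨hx.1, by linarith [hx.2]⟩
    rw [AddCircle.liftIoc_coe_apply hx', mul_comm, Complex.real_smul])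
  have h3 : circ = volume.restrict (Set.Ioo (-Real.pi) Real.pi) :=
    (restrict_Ioo_eq_restrict_Ioc).symm
  rw [h3]
  exact (ae_restrict_iff' measurableSet_Ioo).2 key

/-! ### The space `L²` of the circle -/

/-- The class of a square integrable function in `L²`, and `0` for other functions. -/
def emb (φ : ℝ → ℂ) : Lp ℂ 2 circ := by
  classical exact if h : MemLp φ 2 circ then h.toLp φ else 0

lemma emb_eq {φ : ℝ → ℂ} (h : MemLp φ 2 circ) : emb φ = h.toLp φ := by simp [emb, h]

lemma coeFn_emb {φ : ℝ → ℂ} (h : MemLp φ 2 circ) : emb φ =ᵐ[circ] φ := by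
  rw [emb_eq h]; exact h.coeFn_toLp

lemma emb_coeFn (x : Lp ℂ 2 circ) : emb x = x := by
  rw [emb_eq (Lp.memLp x)]; exact Lp.toLp_coeFn x _

lemma emb_congr {φ ψ : ℝ → ℂ} (h : φ =ᵐ[circ] ψ) : emb φ = emb ψ := by
  by_cases h1 : MemLp φ 2 circ
  · have h2 := (memLp_congr_ae h).1 h1
    rw [emb_eq h1, emb_eq h2]; exact MemLp.toLp_congr h1 h2 h
  · have h2 : ¬ MemLp ψ 2 circ := fun h2 => h1 ((memLp_congr_ae h).2 h2)
    simp [emb, h1, h2]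

lemma emb_sub {φ ψ : ℝ → ℂ} (hφ : MemLp φ 2 circ) (hψ : MemLp ψ 2 circ) :
    emb φ - emb ψ = emb fun θ => φ θ - ψ θ := by
  rw [emb_eq hφ, emb_eq hψ, ← MemLp.toLp_sub hφ hψ, ← emb_eq]; rfl

lemma emb_add {φ ψ : ℝ → ℂ} (hφ : MemLp φ 2 circ) (hψ : MemLp ψ 2 circ) :
    emb φ + emb ψ = emb fun θ => φ θ + ψ θ := by
  rw [emb_eq hφ, emb_eq hψ, ← MemLp.toLp_add hφ hψ, ← emb_eq]; rfl

lemma emb_smul (z : ℂ) {φ : ℝ → ℂ} (hφ : MemLp φ 2 circ) :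
    z • emb φ = emb fun θ => z * φ θ := by
  rw [emb_eq hφ, emb_eq (hφ.const_mul z)]; exact (MemLp.toLp_const_smul z hφ).symm

lemma inner_emb_left {φ : ℝ → ℂ} (hφ : MemLp φ 2 circ) (x : Lp ℂ 2 circ) :
    inner ℂ (emb φ) x = ∫ θ, x θ * conj (φ θ) ∂circ := by
  rw [L2.inner_def]
  refine integral_congr_ae ?_
  filter_upwards [coeFn_emb hφ] with θ h
  rw [h, RCLike.inner_apply]

lemma inner_emb {φ ψ : ℝ → ℂ} (hφ : MemLp φ 2 circ) (hψ : MemLp ψ 2 circ) :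
    inner ℂ (emb φ) (emb ψ) = ∫ θ, ψ θ * conj (φ θ) ∂circ := by
  rw [inner_emb_left hφ]
  refine integral_congr_ae ?_
  filter_upwards [coeFn_emb hψ] with θ h
  rw [h]

lemma norm_emb_sq {φ : ℝ → ℂ} (hφ : MemLp φ 2 circ) :
    ‖emb φ‖ ^ 2 = ∫ θ, ‖φ θ‖ ^ 2 ∂circ := by
  have h := inner_self_eq_norm_sq_to_K (𝕜 := ℂ) (emb φ)
  rw [inner_emb hφ hφ] at h
  have h2 : ∀ θ, φ θ * conj (φ θ) = ((‖φ θ‖ ^ 2 : ℝ) : ℂ) := fun θ => by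
    rw [Complex.mul_conj, Complex.normSq_eq_norm_sq]
  simp only [h2] at h
  rw [integral_complex_ofReal] at h
  apply Complex.ofReal_injective
  rw [Complex.ofReal_pow]
  exact h.symm

/-- Multiplication by an essentially bounded function, as an operator of `L²`. -/
def mulOp (m : ℝ → ℂ) : Lp ℂ 2 circ →L[ℂ] Lp ℂ 2 circ := by
  classical exact if h : MemLp m ∞ circ then
    (ContinuousLinearMap.mul ℂ ℂ).holderL circ ∞ 2 2 (h.toLp m) else 0

lemma coeFn_mulOp {m : ℝ → ℂ} (hm : MemLp m ∞ circ) (x : Lp ℂ 2 circ) :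
    mulOp m x =ᵐ[circ] fun θ => m θ * x θ := by
  have h1 : mulOp m x = (ContinuousLinearMap.mul ℂ ℂ).holder 2 (hm.toLp m) x := by
    simp only [mulOp, hm, dite_true]; rfl
  rw [h1]
  filter_upwards [(ContinuousLinearMap.mul ℂ ℂ).coeFn_holder (r := 2) (hm.toLp m) x,
    hm.coeFn_toLp] with θ h2 h3
  rw [h2, h3]; rfl

lemma memLp_mul {m φ : ℝ → ℂ} (hm : MemLp m ∞ circ) (hφ : MemLp φ 2 circ) :
    MemLp (fun θ => m θ * φ θ) 2 circ :=
  MemLp.mul (p := ∞) (q := 2) (r := 2) hφ hm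

lemma mulOp_emb {m φ : ℝ → ℂ} (hm : MemLp m ∞ circ) (hφ : MemLp φ 2 circ) :
    mulOp m (emb φ) = emb fun θ => m θ * φ θ := by
  refine Lp.ext ?_
  filter_upwards [coeFn_mulOp hm (emb φ), coeFn_emb hφ, coeFn_emb (memLp_mul hm hφ)] with
    θ h1 h2 h3
  rw [h1, h2, h3]

lemma memLp_ex (k : ℤ) : MemLp (ex k) ∞ circ :=
  memLp_top_of_bound (continuous_ex k).aestronglyMeasurable 1
    (.of_forall fun θ => (norm_ex k θ).le)

lemma memLp_two_of_top {m : ℝ → ℂ} (hm : MemLp m ∞ circ) : MemLp m 2 circ :=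
  hm.mono_exponent le_top

/-! ### Weighted exponentials and their closed spans -/

/-- The exponential `e^{ikθ}` of `L²(v²)`, carried over to `L²` by multiplication with `v`. -/
def wex (v : ℝ → ℝ) (k : ℤ) : Lp ℂ 2 circ := emb fun θ => ex k θ * (v θ : ℂ)

/-- The closed span of the weighted exponentials with frequencies in `S`. -/
def wspan (v : ℝ → ℝ) (S : Set ℤ) : Submodule ℂ (Lp ℂ 2 circ) :=
  (Submodule.span ℂ (wex v '' S)).topologicalClosure

instance completeSpace_wspan (v : ℝ → ℝ) (S : Set ℤ) : CompleteSpace (wspan v S) :=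
  (Submodule.isClosed_topologicalClosure _).completeSpace_coe

lemma isClosed_wspan (v : ℝ → ℝ) (S : Set ℤ) : IsClosed (wspan v S : Set (Lp ℂ 2 circ)) :=
  Submodule.isClosed_topologicalClosure _

lemma wex_mem_wspan (v : ℝ → ℝ) {S : Set ℤ} {k : ℤ} (hk : k ∈ S) : wex v k ∈ wspan v S :=
  Submodule.le_topologicalClosure _ (Submodule.subset_span ⟨k, hk, rfl⟩)

lemma wspan_le {v : ℝ → ℝ} {S : Set ℤ} {K : Submodule ℂ (Lp ℂ 2 circ)}
    (hK : IsClosed (K : Set (Lp ℂ 2 circ))) (h : ∀ k ∈ S, wex v k ∈ K) : wspan v S ≤ K := by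
  refine Submodule.topologicalClosure_minimal _ (Submodule.span_le.2 ?_) hK
  rintro _ ⟨k, hk, rfl⟩
  exact h k hk

lemma map_mem_of_mem_wspan {v : ℝ → ℝ} {S : Set ℤ} (T : Lp ℂ 2 circ →L[ℂ] Lp ℂ 2 circ)
    {K : Submodule ℂ (Lp ℂ 2 circ)} (hK : IsClosed (K : Set (Lp ℂ 2 circ)))
    (h : ∀ k ∈ S, T (wex v k) ∈ K) {x : Lp ℂ 2 circ} (hx : x ∈ wspan v S) : T x ∈ K := by
  have : wspan v S ≤ K.comap T.toLinearMap := wspan_le (hK.preimage T.continuous) h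
  exact this hx

lemma inner_eq_zero_of_mem_wspan {v : ℝ → ℝ} {S : Set ℤ} {z x : Lp ℂ 2 circ}
    (h : ∀ k ∈ S, inner ℂ z (wex v k) = 0) (hx : x ∈ wspan v S) : inner ℂ z x = 0 := by
  have : wspan v S ≤ LinearMap.ker (innerSL ℂ z).toLinearMap :=
    wspan_le (innerSL ℂ z).isClosed_ker h
  exact this hx

lemma mem_wspan_orthogonal {v : ℝ → ℝ} {S : Set ℤ} {z : Lp ℂ 2 circ} :
    z ∈ (wspan v S)ᗮ ↔ ∀ k ∈ S, inner ℂ (wex v k) z = 0 := by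
  refine ⟨fun h k hk => h _ (wex_mem_wspan v hk), fun h => ?_⟩
  rw [Submodule.mem_orthogonal']
  exact fun x hx => inner_eq_zero_of_mem_wspan
    (fun k hk => by rw [← inner_conj_symm, h k hk, map_zero]) hx

/-- `v²` and its reciprocal `u²` are both integrable. -/
structure IsDual (v u : ℝ → ℝ) : Prop where
  left : MemLp (fun θ => (v θ : ℂ)) 2 circ
  right : MemLp (fun θ => (u θ : ℂ)) 2 circ
  mul : ∀ᵐ θ ∂circ, (v θ : ℂ) * u θ = 1

lemma IsDual.symm {v u : ℝ → ℝ} (h : IsDual v u) : IsDual u v :=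
  ⟨h.right, h.left, by filter_upwards [h.mul] with θ hθ; rw [mul_comm, hθ]⟩

lemma isDual_one : IsDual (fun _ => 1) fun _ => 1 :=
  ⟨memLp_const _, memLp_const _, by simp⟩

lemma memLp_ex_mul {v : ℝ → ℝ} (hv : MemLp (fun θ => (v θ : ℂ)) 2 circ) (k : ℤ) :
    MemLp (fun θ => ex k θ * (v θ : ℂ)) 2 circ := memLp_mul (memLp_ex k) hv

lemma inner_wex {v : ℝ → ℝ} (hv : MemLp (fun θ => (v θ : ℂ)) 2 circ) (k : ℤ)
    (x : Lp ℂ 2 circ) : inner ℂ (wex v k) x = ∫ θ, x θ * v θ * ex (-k) θ ∂circ := by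
  rw [wex, inner_emb_left (memLp_ex_mul hv k)]
  congr 1; ext θ
  rw [map_mul, conj_ex, Complex.conj_ofReal]; ring

lemma inner_wex_emb {v : ℝ → ℝ} (hv : MemLp (fun θ => (v θ : ℂ)) 2 circ) (k : ℤ) {φ : ℝ → ℂ}
    (hφ : MemLp φ 2 circ) : inner ℂ (wex v k) (emb φ) = ∫ θ, φ θ * v θ * ex (-k) θ ∂circ := by
  rw [inner_wex hv]
  refine integral_congr_ae ?_
  filter_upwards [coeFn_emb hφ] with θ h
  rw [h]

/-- The weights cancel because `u v = 1`. This biorthogonality lets each family read off the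
coefficients of the other. -/
lemma inner_wex_wex {v u : ℝ → ℝ} (h : IsDual v u) (j k : ℤ) :
    inner ℂ (wex u j) (wex v k) = if k = j then ((2 * Real.pi : ℝ) : ℂ) else 0 := by
  rw [wex, wex, ← wex, inner_wex_emb h.right j (memLp_ex_mul h.left k)]
  have : ∀ᵐ θ ∂circ, ex k θ * (v θ : ℂ) * u θ * ex (-j) θ = ex (k - j) θ := by
    filter_upwards [h.mul] with θ hθ
    rw [mul_assoc (ex k θ), hθ, mul_one, sub_eq_add_neg, ex_add]
  rw [integral_congr_ae this, integral_ex]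
  simp [sub_eq_zero]

lemma mulOp_ex_wex {v : ℝ → ℝ} (hv : MemLp (fun θ => (v θ : ℂ)) 2 circ) (j k : ℤ) :
    mulOp (ex j) (wex v k) = wex v (j + k) := by
  rw [wex, mulOp_emb (memLp_ex j) (memLp_ex_mul hv k), wex]
  congr 1; ext θ; rw [ex_add]; ring

lemma integrable_mul_coeFn (x y : Lp ℂ 2 circ) : Integrable (fun θ => x θ * y θ) circ :=
  (Lp.memLp x).integrable_mul (Lp.memLp y)

lemma Integrable.mul_ex {φ : ℝ → ℂ} (hφ : Integrable φ circ) (k : ℤ) :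
    Integrable (fun θ => φ θ * ex k θ) circ :=
  hφ.mul_bdd (c := 1) (continuous_ex k).aestronglyMeasurable (.of_forall fun θ => (norm_ex k θ).le)

/-- An integrable function all of whose nonzero Fourier coefficients vanish is constant. -/
lemma ae_eq_const_of_integral_ex {φ : ℝ → ℂ} (hφ : Integrable φ circ)
    (h1 : ∀ k : ℤ, 0 < k → ∫ θ, φ θ * ex k θ ∂circ = 0)
    (h2 : ∀ k : ℤ, 0 < k → ∫ θ, φ θ * ex (-k) θ ∂circ = 0) :
    ∃ c : ℂ, ∀ᵐ θ ∂circ, φ θ = c := by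
  -- The mean value of `φ`, chosen so that `φ - c` also has vanishing coefficient of order `0`.
  set c : ℂ := (∫ θ, φ θ ∂circ) / ((2 * Real.pi : ℝ) : ℂ)
  have hpi : ((2 * Real.pi : ℝ) : ℂ) ≠ 0 := by
    exact_mod_cast (mul_pos two_pos Real.pi_pos).ne'
  refine ⟨c, ?_⟩
  have hint : Integrable (fun θ => φ θ - c) circ := hφ.sub (integrable_const c)
  have := ae_eq_zero_of_integral_ex hint fun k => by
    have : ∫ θ, (φ θ - c) * ex k θ ∂circ = ∫ θ, φ θ * ex k θ ∂circ - c * ∫ θ, ex k θ ∂circ := by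
      rw [← integral_const_mul, ← integral_sub (Integrable.mul_ex hφ k)
        (Integrable.mul_ex (integrable_const c) k)]
      congr 1; ext θ; ring
    rw [this, integral_ex]
    rcases lt_trichotomy k 0 with hk | hk | hk
    · rw [if_neg hk.ne, ← neg_neg k, h2 (-k) (by omega)]; simp
    · subst hk
      simp only [ex_zero, mul_one, if_true, c]
      rw [div_mul_cancel₀ _ hpi, sub_self]
    · rw [if_neg hk.ne', h1 k hk]; simp
  filter_upwards [this] with θ hθ
  exact sub_eq_zero.1 hθ

/-- The Szegő extremal function: a function of constant modulus in the analytic span, orthogonal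
to the exponentials of positive frequency. -/
lemma exists_extremal {v u : ℝ → ℝ} (h : IsDual v u) :
    ∃ x : Lp ℂ 2 circ, (∀ᵐ θ ∂circ, ‖x θ‖ = 1) ∧ x ∈ wspan v (Set.Ici 0) ∧
      ∀ k : ℤ, 0 < k → inner ℂ (wex v k) x = 0 := by
  set K := wspan v (Set.Ioi 0)
  have hK : K ≤ wspan v (Set.Ici 0) := wspan_le (isClosed_wspan _ _) fun k hk =>
    wex_mem_wspan v (Set.mem_Ici.2 (le_of_lt (Set.mem_Ioi.1 hk)))
  -- The part of the constant function that the positive frequencies cannot approximate.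
  set d := wex v 0 - K.starProjection (wex v 0) with hd
  have hmem : d ∈ wspan v (Set.Ici 0) := sub_mem (wex_mem_wspan v (Set.mem_Ici.2 le_rfl))
    (hK (K.starProjection_apply_mem _))
  have horth : d ∈ Kᗮ := K.sub_starProjection_mem_orthogonal _
  -- A positive shift moves all of `wspan v (Set.Ici 0)` into `K`, to which `d` is orthogonal. Hence
  -- `|d|²` has no nonzero frequencies.
  have hshift : ∀ k : ℤ, 0 < k → inner ℂ (mulOp (ex k) d) d = 0 := fun k hk => by
    have : mulOp (ex k) d ∈ K := map_mem_of_mem_wspan _ (isClosed_wspan _ _) (fun j hj => by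
      rw [mulOp_ex_wex h.left]
      exact wex_mem_wspan v (Set.mem_Ioi.2 (by have := Set.mem_Ici.1 hj; omega))) hmem
    exact horth _ this
  -- Pairing with `wex u 0` kills `K` but not `wex v 0`, so `d ≠ 0`; this is where the integrability
  -- of `u²` enters.
  have hpos : inner ℂ (wex u 0) d = ((2 * Real.pi : ℝ) : ℂ) := by
    rw [hd, inner_sub_right, inner_wex_wex h, if_pos rfl,
      inner_eq_zero_of_mem_wspan (v := v) (S := Set.Ioi 0) (fun k hk => ?_)
      (K.starProjection_apply_mem _), sub_zero]
    rw [inner_wex_wex h, if_neg (ne_of_gt hk)]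
  have hne : d ≠ 0 := fun h0 => by
    rw [h0, inner_zero_right] at hpos
    exact (mul_pos two_pos Real.pi_pos).ne (by exact_mod_cast hpos)
  have hcoef : ∀ k : ℤ, 0 < k → ∫ θ, d θ * conj (d θ) * ex (-k) θ ∂circ = 0 := fun k hk => by
    rw [← hshift k hk, L2.inner_def]
    refine integral_congr_ae ?_
    filter_upwards [coeFn_mulOp (memLp_ex k) d] with θ hθ
    rw [hθ, RCLike.inner_apply, map_mul, conj_ex]; ring
  have hint : Integrable (fun θ => d θ * conj (d θ)) circ :=
    (Lp.memLp d).integrable_mul (Lp.memLp d).star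
  obtain ⟨c, hc⟩ := ae_eq_const_of_integral_ex hint (fun k hk => by
    have := congrArg conj (hcoef k hk)
    rw [← integral_conj, map_zero] at this
    rw [← this]
    congr 1; ext θ
    rw [map_mul, map_mul, Complex.conj_conj, conj_ex, neg_neg]; ring) hcoef
  have hsq : ∀ᵐ θ ∂circ, ‖d θ‖ = Real.sqrt ‖c‖ := by
    filter_upwards [hc] with θ hθ
    rw [← hθ, norm_mul, RCLike.norm_conj, Real.sqrt_mul_self (norm_nonneg _)]
  have hs : 0 < Real.sqrt ‖c‖ := by
    refine lt_of_le_of_ne (Real.sqrt_nonneg _) fun h0 => hne ?_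
    refine Lp.ext ?_
    filter_upwards [hsq, Lp.coeFn_zero ℂ 2 circ] with θ h1 h2
    rw [h2]; exact norm_eq_zero.1 (h1.trans h0.symm)
  refine ⟨(((Real.sqrt ‖c‖)⁻¹ : ℝ) : ℂ) • d, ?_, Submodule.smul_mem _ _ hmem, fun k hk => ?_⟩
  · filter_upwards [hsq, Lp.coeFn_smul (((Real.sqrt ‖c‖)⁻¹ : ℝ) : ℂ) d] with θ h1 h2
    rw [h2, Pi.smul_apply, norm_smul, h1, Complex.norm_real, Real.norm_of_nonneg (by positivity),
      inv_mul_cancel₀ hs.ne']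
  · rw [inner_smul_right, horth _ (wex_mem_wspan v (Set.mem_Ioi.2 hk)), mul_zero]

lemma memLp_top_of_norm_eq_one {x : Lp ℂ 2 circ} (hx : ∀ᵐ θ ∂circ, ‖x θ‖ = 1) :
    MemLp x ∞ circ :=
  memLp_top_of_bound (Lp.aestronglyMeasurable x) 1 (hx.mono fun _ h => h.le)

/-- The integral of `x y` as an inner product. -/
lemma integral_mul_eq_inner (x y : Lp ℂ 2 circ) (k : ℤ) :
    ∫ θ, x θ * y θ * ex k θ ∂circ = inner ℂ (emb fun θ => conj (ex k θ * y θ)) x := by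
  have h : MemLp (fun θ => conj (ex k θ * y θ)) 2 circ :=
    (memLp_mul (memLp_ex k) (Lp.memLp y)).star
  rw [inner_emb_left h]
  congr 1; ext θ; rw [Complex.conj_conj]; ring

lemma integral_wex_mul {v : ℝ → ℝ} (hv : MemLp (fun θ => (v θ : ℂ)) 2 circ) (i k : ℤ)
    (y : Lp ℂ 2 circ) :
    ∫ θ, wex v i θ * y θ * ex k θ ∂circ = inner ℂ (wex v (-(i + k))) y := by
  rw [inner_wex hv, neg_neg]
  refine integral_congr_ae ?_
  filter_upwards [coeFn_emb (memLp_ex_mul hv i)] with θ hθ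
  rw [wex, hθ, ex_add]; ring

/-- The integral is an inner product with `x` in the linear slot, so it need only vanish at the
generators of the span. -/
lemma integral_mul_wex_eq_zero {v : ℝ → ℝ} (hv : MemLp (fun θ => (v θ : ℂ)) 2 circ)
    {S : Set ℤ} {x y : Lp ℂ 2 circ} (hx : x ∈ wspan v S) {k : ℤ}
    (h : ∀ i ∈ S, inner ℂ (wex v (-(i + k))) y = 0) : ∫ θ, x θ * y θ * ex k θ ∂circ = 0 := by
  rw [integral_mul_eq_inner]
  refine inner_eq_zero_of_mem_wspan (fun i hi => ?_) hx
  rw [← integral_mul_eq_inner, integral_wex_mul hv, h i hi]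

/-- The product of analytic functions of reciprocal weighted spaces is analytic. -/
lemma integral_mul_eq_zero {v u : ℝ → ℝ} (h : IsDual v u) {x y : Lp ℂ 2 circ}
    (hx : x ∈ wspan v (Set.Ici 0)) (hy : y ∈ wspan u (Set.Ici 0)) {k : ℤ} (hk : 0 < k) :
    ∫ θ, x θ * y θ * ex k θ ∂circ = 0 := by
  refine integral_mul_wex_eq_zero h.left hx fun i hi => inner_eq_zero_of_mem_wspan
    (fun j hj => ?_) hy
  rw [inner_wex_wex h.symm, if_neg]
  have := Set.mem_Ici.1 hi; have := Set.mem_Ici.1 hj; omega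

/-- The component of `x` orthogonal to the nonnegative exponentials is orthogonal to the negative
ones too, hence has no Fourier coefficients and is zero. -/
lemma mem_wspan_one {x : Lp ℂ 2 circ}
    (hx : ∀ k : ℤ, k < 0 → inner ℂ (wex (fun _ => 1) k) x = 0) :
    x ∈ wspan (fun _ => 1) (Set.Ici 0) := by
  set K := wspan (fun _ => 1) (Set.Ici 0)
  have horth : x - K.starProjection x ∈ Kᗮ := K.sub_starProjection_mem_orthogonal _
  have hz : ∀ k : ℤ, inner ℂ (wex (fun _ => 1) k) (x - K.starProjection x) = 0 := fun k => by
    rcases lt_or_ge k 0 with hk | hk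
    · rw [inner_sub_right, hx k hk, inner_eq_zero_of_mem_wspan (v := fun _ => 1)
        (S := Set.Ici 0) (fun j hj => ?_) (K.starProjection_apply_mem _), sub_zero]
      rw [inner_wex_wex isDual_one, if_neg]
      have := Set.mem_Ici.1 hj; omega
    · exact horth _ (wex_mem_wspan _ hk)
  have h0 : x - K.starProjection x = 0 := by
    refine Lp.ext ((ae_eq_zero_of_integral_ex ((Lp.memLp _).integrable one_le_two)
      fun k => ?_).trans (Lp.coeFn_zero ℂ 2 circ).symm)
    have := hz (-k)
    rw [inner_wex isDual_one.left, neg_neg] at this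
    simpa using this
  rw [sub_eq_zero.1 h0]
  exact K.starProjection_apply_mem _

/-- A function of the weighted `L²` space whose Fourier coefficients of negative order vanish
belongs to the closed span of the exponentials of nonnegative order. -/
lemma orthogonal_le_wspan {v u : ℝ → ℝ} (h : IsDual v u) :
    (wspan u (Set.Iio 0))ᗮ ≤ wspan v (Set.Ici 0) := by
  intro z hz
  rw [mem_wspan_orthogonal] at hz
  obtain ⟨x, hx1, hx2, hx3⟩ := exists_extremal h
  obtain ⟨y, hy1, hy2, hy3⟩ := exists_extremal h.symm
  have hxt := memLp_top_of_norm_eq_one hx1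
  have hyt := memLp_top_of_norm_eq_one hy1
  -- Orthogonality of `d` to positive frequencies says that the conjugate of `d`, times the weight,
  -- has no negative ones.
  have hconj : ∀ {w : ℝ → ℝ} {d : Lp ℂ 2 circ}, MemLp (fun θ => (w θ : ℂ)) 2 circ →
      MemLp d ∞ circ → (∀ k : ℤ, 0 < k → inner ℂ (wex w k) d = 0) →
      MemLp (fun θ => conj (d θ) * (w θ : ℂ)) 2 circ ∧
      emb (fun θ => conj (d θ) * (w θ : ℂ)) ∈ wspan (fun _ => 1) (Set.Ici 0) := by
    intro w d hw hd h0
    have hm : MemLp (fun θ => conj (d θ) * (w θ : ℂ)) 2 circ := memLp_mul hd.star hw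
    refine ⟨hm, mem_wspan_one fun k hk => ?_⟩
    have := congrArg conj (h0 (-k) (by omega))
    rw [inner_wex hw, ← integral_conj, map_zero] at this
    rw [inner_wex_emb isDual_one.left k hm, ← this]
    congr 1; ext θ
    rw [map_mul, map_mul, conj_ex, Complex.conj_ofReal, neg_neg, Complex.ofReal_one, mul_one]
  obtain ⟨hmx, hcx⟩ := hconj h.left hxt hx3
  obtain ⟨hmy, hcy⟩ := hconj h.right hyt hy3
  -- Both `x y` and its conjugate are analytic: the latter is the product of `conj x * v` and `conj
  -- y * u`, since `v u = 1`. So `x y` is constant, and of modulus one.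
  obtain ⟨κ, hκ⟩ := ae_eq_const_of_integral_ex (integrable_mul_coeFn x y)
    (fun k hk => integral_mul_eq_zero h hx2 hy2 hk) (fun k hk => by
      have := congrArg conj (integral_mul_eq_zero isDual_one hcx hcy hk)
      rw [← integral_conj, map_zero] at this
      rw [← this]
      refine integral_congr_ae ?_
      filter_upwards [coeFn_emb hmx, coeFn_emb hmy, h.mul] with θ h1 h2 h3
      rw [h1, h2]
      simp only [map_mul, conj_ex, Complex.conj_conj, Complex.conj_ofReal]
      linear_combination -(x θ * y θ * ex (-k) θ) * h3)
  have hκ0 : κ ≠ 0 := by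
    rintro rfl
    have : ∀ᵐ θ ∂circ, False := by
      filter_upwards [hκ, hx1, hy1] with θ h1 h2 h3
      have := congrArg norm h1
      rw [norm_mul, h2, h3] at this
      simp at this
    rw [ae_iff] at this
    simp [circ] at this
    linarith [Real.pi_pos]
  -- `y` is analytic in the `u`-weighted space and `z` is orthogonal to its negative exponentials,
  -- so `y z` belongs to the unweighted Hardy space.
  have hX : mulOp y z ∈ wspan (fun _ => 1) (Set.Ici 0) := mem_wspan_one fun k hk => by
    have : ∫ θ, y θ * z θ * ex (-k) θ ∂circ = 0 :=
      integral_mul_wex_eq_zero h.right hy2 fun i hi => hz _ (by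
        have := Set.mem_Ici.1 hi
        rw [Set.mem_Iio]; omega)
    rw [inner_wex isDual_one.left, ← this]
    refine integral_congr_ae ?_
    filter_upwards [coeFn_mulOp hyt z] with θ hθ
    rw [hθ, Complex.ofReal_one, mul_one]
  -- Multiplication by the bounded `x` maps the Hardy space into `wspan v (Set.Ici 0)`, because it
  -- sends `e^{ijθ}` to a shift of `x`. As `x y = κ`, this recovers `z` up to the constant.
  have hXx : mulOp x (mulOp y z) ∈ wspan v (Set.Ici 0) :=
    map_mem_of_mem_wspan _ (isClosed_wspan _ _) (fun j hj => by
      have h1 : mulOp x (wex (fun _ => 1) j) = mulOp (ex j) x := by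
        refine Lp.ext ?_
        filter_upwards [coeFn_mulOp hxt (wex (fun _ => 1) j), coeFn_mulOp (memLp_ex j) x,
          coeFn_emb (memLp_ex_mul isDual_one.left j)] with θ h1 h2 h3
        rw [h1, h2, wex, h3, Complex.ofReal_one, mul_one, mul_comm]
      rw [h1]
      exact map_mem_of_mem_wspan _ (isClosed_wspan _ _) (fun i hi => by
        rw [mulOp_ex_wex h.left]
        exact wex_mem_wspan v (Set.mem_Ici.2 (add_nonneg (Set.mem_Ici.1 hj) (Set.mem_Ici.1 hi)))) hx2) hX
  have hz' : z = κ⁻¹ • mulOp x (mulOp y z) := by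
    refine Lp.ext ?_
    filter_upwards [coeFn_mulOp hxt (mulOp y z), coeFn_mulOp hyt z, hκ,
      Lp.coeFn_smul κ⁻¹ (mulOp x (mulOp y z))] with θ h1 h2 h3 h4
    rw [h4, Pi.smul_apply, h1, h2, smul_eq_mul, ← mul_assoc (x θ), h3, inv_mul_cancel_left₀ hκ0]
  rw [hz']
  exact Submodule.smul_mem _ _ hXx

/-- Take orthogonal complements in the preceding inclusion with the weights exchanged; the span is
closed, so its double complement is itself. -/
lemma wspan_orthogonal_le {v u : ℝ → ℝ} (h : IsDual v u) :
    (wspan u (Set.Ici 0))ᗮ ≤ wspan v (Set.Iio 0) := by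
  have := Submodule.orthogonal_le (orthogonal_le_wspan h.symm)
  rwa [Submodule.orthogonal_orthogonal] at this

/-! ### Trigonometric polynomials and the weighted distance -/

lemma trigPoly_zero (θ : ℝ) : trigPoly 0 θ = 0 := by simp [trigPoly]

lemma trigPoly_add (p q : ℤ →₀ ℂ) (θ : ℝ) : trigPoly (p + q) θ = trigPoly p θ + trigPoly q θ :=
  Finsupp.sum_add_index' (by simp) (by intros; ring)

lemma trigPoly_single (k : ℤ) (z : ℂ) (θ : ℝ) :
    trigPoly (Finsupp.single k z) θ = z * ex k θ := by
  simp [trigPoly]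

lemma memLp_trigPoly (p : ℤ →₀ ℂ) : MemLp (trigPoly p) ∞ circ := by
  induction p using Finsupp.induction_linear with
  | zero => simp only [funext trigPoly_zero]; exact MemLp.zero'
  | add p q hp hq => simp only [funext (trigPoly_add p q)]; exact hp.add hq
  | single k z => simp only [funext (trigPoly_single k z)]; exact (memLp_ex k).const_mul z

lemma linearCombination_wex {v : ℝ → ℝ} (hv : MemLp (fun θ => (v θ : ℂ)) 2 circ)
    (p : ℤ →₀ ℂ) :
    Finsupp.linearCombination ℂ (wex v) p = emb fun θ => trigPoly p θ * (v θ : ℂ) := by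
  induction p using Finsupp.induction_linear with
  | zero =>
    simp only [map_zero, trigPoly_zero, zero_mul]
    rw [emb_eq (MemLp.zero' (p := 2))]; exact (MemLp.toLp_zero _).symm
  | add p q hp hq =>
    rw [map_add, hp, hq, emb_add (memLp_mul (memLp_trigPoly p) hv)
      (memLp_mul (memLp_trigPoly q) hv)]
    simp only [trigPoly_add, add_mul]
  | single k z =>
    rw [Finsupp.linearCombination_single, wex, emb_smul z (memLp_ex_mul hv k)]
    simp only [trigPoly_single, mul_assoc]

lemma sqDist_eq_eLpNorm {w v : ℝ → ℝ} (h : ∀ᵐ θ ∂circ, w θ = v θ ^ 2) (φ : ℝ → ℂ) :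
    sqDist w φ = eLpNorm (fun θ => φ θ * (v θ : ℂ)) 2 circ ^ 2 := by
  have h2 := eLpNorm_nnreal_pow_eq_lintegral (μ := circ) (f := fun θ => φ θ * (v θ : ℂ))
    (p := 2) two_ne_zero
  have h3 : ((2 : NNReal) : ℝ) = ((2 : ℕ) : ℝ) := by norm_num
  simp only [h3, ENNReal.rpow_natCast] at h2
  rw [sqDist]
  refine Eq.trans ?_ h2.symm
  refine lintegral_congr_ae ?_
  filter_upwards [h] with θ hθ
  rw [hθ, enorm_mul, mul_pow, ← sq_abs, ENNReal.ofReal_pow (abs_nonneg _), ← Real.norm_eq_abs,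
    ofReal_norm]
  congr 2
  rw [← ofReal_norm, ← ofReal_norm, Complex.norm_real]

lemma sqDist_eq_norm {w v : ℝ → ℝ} (h : ∀ᵐ θ ∂circ, w θ = v θ ^ 2) {φ : ℝ → ℂ}
    (hφ : MemLp (fun θ => φ θ * (v θ : ℂ)) 2 circ) :
    sqDist w φ = ENNReal.ofReal (‖emb fun θ => φ θ * (v θ : ℂ)‖ ^ 2) := by
  rw [sqDist_eq_eLpNorm h, emb_eq hφ, Lp.norm_toLp, ENNReal.ofReal_pow ENNReal.toReal_nonneg,
    ENNReal.ofReal_toReal hφ.2.ne]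

/-- Translates approximation in `L²(w)` into norm convergence in `L²`. The forward direction also
yields that `φ v` is square integrable. -/
lemma tendsto_sqDist_iff {w v : ℝ → ℝ} (h : ∀ᵐ θ ∂circ, w θ = v θ ^ 2)
    (hv : MemLp (fun θ => (v θ : ℂ)) 2 circ) {φ : ℝ → ℂ} (hφ : AEStronglyMeasurable φ circ)
    (p : ℕ → (ℤ →₀ ℂ)) :
    Tendsto (fun n => sqDist w fun θ => φ θ - trigPoly (p n) θ) atTop (𝓝 0) ↔
      MemLp (fun θ => φ θ * (v θ : ℂ)) 2 circ ∧
      Tendsto (fun n => Finsupp.linearCombination ℂ (wex v) (p n)) atTop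
        (𝓝 (emb fun θ => φ θ * (v θ : ℂ))) := by
  have hp : ∀ n, MemLp (fun θ => trigPoly (p n) θ * (v θ : ℂ)) 2 circ := fun n =>
    memLp_mul (memLp_trigPoly _) hv
  have key : MemLp (fun θ => φ θ * (v θ : ℂ)) 2 circ → ∀ n,
      sqDist w (fun θ => φ θ - trigPoly (p n) θ) = ENNReal.ofReal
        (‖Finsupp.linearCombination ℂ (wex v) (p n) - emb fun θ => φ θ * (v θ : ℂ)‖ ^ 2) := by
    intro hm n
    have h1 : (fun θ => (φ θ - trigPoly (p n) θ) * (v θ : ℂ)) =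
        fun θ => φ θ * (v θ : ℂ) - trigPoly (p n) θ * (v θ : ℂ) := by ext θ; ring
    rw [sqDist_eq_norm h (by rw [h1]; exact hm.sub (hp n)), h1, ← emb_sub hm (hp n),
      ← linearCombination_wex hv, norm_sub_rev]
  constructor
  · intro ht
    obtain ⟨n, hn⟩ := (ht.eventually_lt_const (u := 1) one_pos).exists
    rw [sqDist_eq_eLpNorm h] at hn
    -- A single finite distance suffices: `φ v` differs from a square integrable function by a
    -- square integrable one.
    have hm : MemLp (fun θ => φ θ * (v θ : ℂ)) 2 circ := by
      have h1 : MemLp (fun θ => (φ θ - trigPoly (p n) θ) * (v θ : ℂ)) 2 circ := by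
        refine ⟨(hφ.sub (memLp_trigPoly _).1).mul hv.1, ?_⟩
        by_contra h0
        rw [not_lt, top_le_iff] at h0
        rw [h0] at hn
        simp at hn
      have := h1.add (hp n)
      refine this.congr_norm (hφ.mul hv.1) (.of_forall fun θ => ?_)
      simp only [Pi.add_apply]; congr 1; ring
    refine ⟨hm, ?_⟩
    simp only [key hm] at ht
    have h1 := (ENNReal.tendsto_toReal (a := 0) (by simp)).comp ht
    have h2 : Tendsto (fun n => ‖Finsupp.linearCombination ℂ (wex v) (p n) -
        emb fun θ => φ θ * (v θ : ℂ)‖ ^ 2) atTop (𝓝 0) := by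
      simpa [Function.comp_def, ENNReal.toReal_ofReal, sq_nonneg] using h1
    rw [tendsto_iff_norm_sub_tendsto_zero]
    have h3 := h2.sqrt
    simpa [Real.sqrt_sq] using h3
  · rintro ⟨hm, ht⟩
    simp only [key hm]
    rw [tendsto_iff_norm_sub_tendsto_zero] at ht
    have := ENNReal.tendsto_ofReal (ht.pow 2)
    simpa using this

lemma exists_seq_of_mem_wspan {v : ℝ → ℝ} {S : Set ℤ} {x : Lp ℂ 2 circ} (hx : x ∈ wspan v S) :
    ∃ p : ℕ → (ℤ →₀ ℂ), (∀ n, ∀ k ∈ (p n).support, k ∈ S) ∧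
      Tendsto (fun n => Finsupp.linearCombination ℂ (wex v) (p n)) atTop (𝓝 x) := by
  obtain ⟨y, hy, hlim⟩ := mem_closure_iff_seq_limit.1 hx
  choose p hp1 hp2 using fun n => (Finsupp.mem_span_image_iff_linearCombination ℂ).1 (hy n)
  exact ⟨p, fun n k hk => (Finsupp.mem_supported ℂ _).1 (hp1 n) hk, by simpa only [hp2] using hlim⟩

lemma exists_nat_seq_of_mem_wspan {v : ℝ → ℝ} {x : Lp ℂ 2 circ}
    (hx : x ∈ wspan v (Set.Ici 0)) :
    ∃ p : ℕ → (ℕ →₀ ℂ),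
      Tendsto (fun n => Finsupp.linearCombination ℂ (fun j : ℕ => wex v j) (p n)) atTop (𝓝 x) := by
  have h : wex v '' Set.Ici 0 = Set.range fun j : ℕ => wex v j := by
    ext y; constructor
    · rintro ⟨k, hk, rfl⟩
      exact ⟨k.toNat, by simp only [Int.toNat_of_nonneg (Set.mem_Ici.1 hk)]⟩
    · rintro ⟨j, rfl⟩
      exact ⟨j, Set.mem_Ici.2 (by positivity), rfl⟩
  rw [wspan, h] at hx
  obtain ⟨y, hy, hlim⟩ := mem_closure_iff_seq_limit.1 hx
  choose p hp using fun n => (Finsupp.mem_span_range_iff_exists_finsupp).1 (hy n)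
  refine ⟨p, ?_⟩
  simp only [Finsupp.linearCombination_apply, hp]
  exact hlim

lemma linearCombination_nat_mem_wspan (v : ℝ → ℝ) (p : ℕ →₀ ℂ) :
    Finsupp.linearCombination ℂ (fun j : ℕ => wex v j) p ∈ wspan v (Set.Ici 0) := by
  rw [Finsupp.linearCombination_apply]
  exact Submodule.sum_mem _ fun j _ => Submodule.smul_mem _ _
    (wex_mem_wspan v (Set.mem_Ici.2 (by positivity)))

/-! ### Absolutely summable symbols -/

lemma norm_symbolA_le {a : ℕ → ℂ} (ha : Summable fun j => ‖a j‖) (θ : ℝ) :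
    ‖symbolA a θ‖ ≤ ∑' j, ‖a j‖ := by
  have h : ∀ j : ℕ, ‖a j * ex j θ‖ = ‖a j‖ := fun j => by rw [norm_mul, norm_ex, mul_one]
  have := norm_tsum_le_tsum_norm (f := fun j : ℕ => a j * ex j θ) (by simpa only [h] using ha)
  simp only [h] at this
  exact this

lemma continuous_symbolA {a : ℕ → ℂ} (ha : Summable fun j => ‖a j‖) : Continuous (symbolA a) :=
  continuous_tsum (fun j => continuous_const.mul (continuous_ex j)) ha
    fun j θ => by rw [norm_mul, norm_ex, mul_one]

lemma memLp_symbolA {a : ℕ → ℂ} (ha : Summable fun j => ‖a j‖) : MemLp (symbolA a) ∞ circ :=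
  memLp_top_of_bound (continuous_symbolA ha).aestronglyMeasurable _
    (.of_forall (norm_symbolA_le ha))

lemma hasSum_integral_symbolA {a : ℕ → ℂ} (ha : Summable fun j => ‖a j‖) {s : ℝ → ℂ}
    (hs : Integrable s circ) :
    HasSum (fun j : ℕ => a j * ∫ θ, ex j θ * s θ ∂circ) (∫ θ, symbolA a θ * s θ ∂circ) := by
  have h := hasSum_integral_of_summable_integral_norm (μ := circ)
    (F := fun (j : ℕ) θ => a j * (ex j θ * s θ))
    (fun j => ((Integrable.mul_ex hs j).const_mul (a j)).congr
      (.of_forall fun θ => by simp only; ring)) (by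
      simp only [norm_mul, norm_ex, one_mul, integral_const_mul]
      exact ha.mul_right _)
  have h1 : (fun θ => symbolA a θ * s θ) = fun θ => ∑' j : ℕ, a j * (ex j θ * s θ) := by
    ext θ
    rw [symbolA, ← tsum_mul_right]
    congr 1; ext j; ring
  rw [h1]
  simp only [← integral_const_mul]
  exact h

lemma norm_wex {v : ℝ → ℝ} (hv : MemLp (fun θ => (v θ : ℂ)) 2 circ) (k : ℤ) :
    ‖wex v k‖ = ‖wex v 0‖ := by
  have h : ∀ k, ‖wex v k‖ ^ 2 = ∫ θ, ‖(v θ : ℂ)‖ ^ 2 ∂circ := fun k => by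
    rw [wex, norm_emb_sq (memLp_ex_mul hv k)]
    simp only [norm_mul, norm_ex, one_mul]
  rw [← Real.sqrt_sq (norm_nonneg (wex v k)), ← Real.sqrt_sq (norm_nonneg (wex v 0)), h, h]

lemma hasSum_smul_wex {a : ℕ → ℂ} (ha : Summable fun j => ‖a j‖) {v : ℝ → ℝ}
    (hv : MemLp (fun θ => (v θ : ℂ)) 2 circ) :
    HasSum (fun j : ℕ => a j • wex v j) (emb fun θ => symbolA a θ * (v θ : ℂ)) := by
  have hs : Summable fun j : ℕ => a j • wex v j := Summable.of_norm (by
    simp only [norm_smul, norm_wex hv]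
    exact ha.mul_right _)
  convert hs.hasSum
  -- The norm-convergent series is identified weakly, by integrating the symbol termwise against an
  -- arbitrary `z`.
  refine ext_inner_left ℂ fun z => ?_
  have h1 : HasSum (fun j : ℕ => inner ℂ z (a j • wex v j)) (inner ℂ z (∑' j : ℕ, a j • wex v j)) :=
    hs.hasSum.mapL (innerSL ℂ z)
  have hm := memLp_mul (memLp_symbolA ha) hv
  have hint : Integrable (fun θ => (v θ : ℂ) * conj (z θ)) circ :=
    hv.integrable_mul (Lp.memLp z).star
  have h2 := hasSum_integral_symbolA ha hint
  have hz : ∀ {φ : ℝ → ℂ}, MemLp φ 2 circ → inner ℂ z (emb φ) = ∫ θ, φ θ * conj (z θ) ∂circ := by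
    intro φ hφ
    rw [← emb_coeFn z, inner_emb (by exact Lp.memLp z) hφ, emb_coeFn]
  refine Eq.trans ?_ (h2.unique ?_)
  · rw [hz hm]; simp only [mul_assoc]
  · convert h1 using 2 with j
    rw [inner_smul_right, wex, hz (memLp_ex_mul hv _)]; simp only [mul_assoc]

/-! ### The inverse of the Gram matrix of an analytic span -/

lemma pairing_finsupp (z : ℕ → ℂ) (x : ℕ →₀ ℂ) :
    pairing z x = x.sum fun k t => z k * conj t := by
  rw [pairing, tsum_eq_sum (s := x.support) fun k hk => by
    rw [Finsupp.notMem_support_iff.1 hk, map_zero, mul_zero]]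
  rfl

lemma matVec_finsupp (M : ℕ → ℕ → ℂ) (x : ℕ →₀ ℂ) (k : ℕ) :
    matVec M x k = x.sum fun j t => M k j * t := by
  rw [matVec, tsum_eq_sum (s := x.support) fun j hj => by
    rw [Finsupp.notMem_support_iff.1 hj, mul_zero]]
  rfl

/-- The matrix `B` is the normalized Gram matrix of the weighted exponentials, and `y` is the
vector of their normalized inner products with `Y`. -/
structure IsGram (u : ℝ → ℝ) (B : ℕ → ℕ → ℂ) (Y : Lp ℂ 2 circ) (y : ℕ → ℂ) : Prop where
  mat : ∀ k j, B k j = ((1 / (2 * Real.pi) : ℝ) : ℂ) * inner ℂ (wex u k) (wex u j)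
  vec : ∀ k, y k = ((1 / (2 * Real.pi) : ℝ) : ℂ) * inner ℂ (wex u k) Y

/-- The analytic polynomial with coefficients `x`, in the weighted space. -/
def analyticPoly (u : ℝ → ℝ) : (ℕ →₀ ℂ) →ₗ[ℂ] Lp ℂ 2 circ :=
  Finsupp.linearCombination ℂ fun j : ℕ => wex u j

section

variable {u : ℝ → ℝ} {B : ℕ → ℕ → ℂ} {Y : Lp ℂ 2 circ} {y : ℕ → ℂ}

lemma IsGram.matVec_eq (hG : IsGram u B Y y) (x : ℕ →₀ ℂ) (k : ℕ) :
    matVec B x k = ((1 / (2 * Real.pi) : ℝ) : ℂ) * inner ℂ (wex u k) (analyticPoly u x) := by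
  rw [matVec_finsupp, analyticPoly, Finsupp.linearCombination_apply, Finsupp.sum, Finsupp.sum,
    inner_sum, Finset.mul_sum]
  refine Finset.sum_congr rfl fun j _ => ?_
  rw [hG.mat, inner_smul_right]; ring

lemma pairing_eq_inner {Z : Lp ℂ 2 circ} {z : ℕ → ℂ}
    (hz : ∀ k, z k = ((1 / (2 * Real.pi) : ℝ) : ℂ) * inner ℂ (wex u k) Z) (x : ℕ →₀ ℂ) :
    pairing z x = ((1 / (2 * Real.pi) : ℝ) : ℂ) * inner ℂ (analyticPoly u x) Z := by
  rw [pairing_finsupp, analyticPoly, Finsupp.linearCombination_apply, Finsupp.sum, Finsupp.sum,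
    sum_inner, Finset.mul_sum]
  refine Finset.sum_congr rfl fun j _ => ?_
  rw [hz, inner_smul_left]; ring

lemma IsGram.pairing_matVec (hG : IsGram u B Y y) (x : ℕ →₀ ℂ) :
    ‖pairing (matVec B x) x‖ = 1 / (2 * Real.pi) * ‖analyticPoly u x‖ ^ 2 := by
  rw [pairing_eq_inner (hG.matVec_eq x), inner_self_eq_norm_sq_to_K, norm_mul, norm_pow,
    Complex.norm_real, RCLike.norm_ofReal, abs_norm, Real.norm_of_nonneg (by positivity)]

/-- By biorthogonality. It makes each coefficient continuous in the energy norm, although `B` need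
not be boundedly invertible. -/
lemma coeff_analyticPoly {v : ℝ → ℝ} (h : IsDual v u) (x : ℕ →₀ ℂ) (j : ℕ) :
    x j = ((1 / (2 * Real.pi) : ℝ) : ℂ) * inner ℂ (wex v j) (analyticPoly u x) := by
  have hpi : ((1 / (2 * Real.pi) : ℝ) : ℂ) * ((2 * Real.pi : ℝ) : ℂ) = 1 := by
    rw [← Complex.ofReal_mul, one_div_mul_cancel (by positivity), Complex.ofReal_one]
  rw [analyticPoly, Finsupp.linearCombination_apply, Finsupp.sum, inner_sum,
    Finset.sum_eq_single j]
  · rw [inner_smul_right, inner_wex_wex h.symm, if_pos rfl]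
    linear_combination -(x j) * hpi
  · intro i _ hi
    rw [inner_smul_right, inner_wex_wex h.symm, if_neg (by exact_mod_cast hi), mul_zero]
  · intro hj
    rw [Finsupp.notMem_support_iff.1 hj, zero_smul, inner_zero_right]

lemma tendsto_mul_inner {z : Lp ℂ 2 circ} {x : ℕ → Lp ℂ 2 circ} {X : Lp ℂ 2 circ}
    (hx : Tendsto x atTop (𝓝 X)) (t : ℂ) :
    Tendsto (fun n => t * inner ℂ z (x n)) atTop (𝓝 (t * inner ℂ z X)) :=
  (tendsto_const_nhds.inner hx).const_mul t

lemma tendsto_mul_inner_left {z : Lp ℂ 2 circ} {x : ℕ → Lp ℂ 2 circ} {X : Lp ℂ 2 circ}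
    (hx : Tendsto x atTop (𝓝 X)) (t : ℂ) :
    Tendsto (fun n => t * inner ℂ (x n) z) atTop (𝓝 (t * inner ℂ X z)) :=
  (hx.inner tendsto_const_nhds).const_mul t

lemma inner_wex_starProjection (Y : Lp ℂ 2 circ) (k : ℕ) :
    inner ℂ (wex u k) ((wspan u (Set.Ici 0)).starProjection Y) = inner ℂ (wex u k) Y := by
  have := (wspan u (Set.Ici 0)).sub_starProjection_mem_orthogonal Y _
    (wex_mem_wspan u (Set.mem_Ici.2 (Int.natCast_nonneg k)))
  rw [inner_sub_right, sub_eq_zero] at this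
  exact this.symm

/-- Analytic polynomials approximating the projection of `Y` serve as the finite sequences: each of
the four conditions is continuity of the norm or of an inner product. -/
lemma IsGram.isInverse {v : ℝ → ℝ} (h : IsDual v u) (hG : IsGram u B Y y) :
    IsInverse B y
      (fun j => ((1 / (2 * Real.pi) : ℝ) : ℂ) *
        inner ℂ (wex v j) ((wspan u (Set.Ici 0)).starProjection Y))
      (((1 / (2 * Real.pi) : ℝ) : ℂ) *
        inner ℂ ((wspan u (Set.Ici 0)).starProjection Y) Y) := by
  obtain ⟨x, hx⟩ := exists_nat_seq_of_mem_wspan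
    ((wspan u (Set.Ici 0)).starProjection_apply_mem Y)
  change Tendsto (fun n => analyticPoly u (x n)) atTop _ at hx
  refine ⟨x, fun ε hε => ?_, fun k => ?_, fun j => ?_, ?_⟩
  · obtain ⟨N, hN⟩ := Metric.cauchySeq_iff.1 hx.cauchySeq (Real.sqrt (2 * Real.pi * ε))
      (Real.sqrt_pos.2 (by positivity))
    refine ⟨N, fun m hm n hn => ?_⟩
    rw [hG.pairing_matVec, map_sub, ← dist_eq_norm, one_div_mul_eq_div,
      div_lt_iff₀ (by positivity)]
    have := hN m hm n hn
    rw [Real.lt_sqrt dist_nonneg] at this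
    linarith
  · simp only [hG.matVec_eq]
    rw [hG.vec, ← inner_wex_starProjection]
    exact tendsto_mul_inner hx _
  · simp only [coeff_analyticPoly h]
    exact tendsto_mul_inner hx _
  · simp only [pairing_eq_inner hG.vec]
    exact tendsto_mul_inner_left hx _

/-- Being Cauchy in energy means being Cauchy in `L²`, so every admissible sequence has a limit `X`
in the analytic span. This limit is forced to be the projection of `Y`, which determines `c` and
`e`. -/
lemma IsGram.isInverse_unique {v : ℝ → ℝ} (h : IsDual v u) (hG : IsGram u B Y y)
    {c : ℕ → ℂ} {e : ℂ} (hc : IsInverse B y c e) :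
    c = (fun j : ℕ => ((1 / (2 * Real.pi) : ℝ) : ℂ) *
        inner ℂ (wex v j) ((wspan u (Set.Ici 0)).starProjection Y)) ∧
      e = ((1 / (2 * Real.pi) : ℝ) : ℂ) *
        inner ℂ ((wspan u (Set.Ici 0)).starProjection Y) Y := by
  obtain ⟨x, hx1, hx2, hx3, hx4⟩ := hc
  have hpi : ((1 / (2 * Real.pi) : ℝ) : ℂ) ≠ 0 := by
    have : (1 / (2 * Real.pi) : ℝ) ≠ 0 := by positivity
    exact_mod_cast this
  have hcau : CauchySeq fun n => analyticPoly u (x n) := by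
    refine Metric.cauchySeq_iff.2 fun ε hε => ?_
    obtain ⟨N, hN⟩ := hx1 (1 / (2 * Real.pi) * ε ^ 2) (by positivity)
    refine ⟨N, fun m hm n hn => ?_⟩
    have := hN m hm n hn
    rw [hG.pairing_matVec, map_sub, ← dist_eq_norm] at this
    exact lt_of_pow_lt_pow_left₀ 2 hε.le (lt_of_mul_lt_mul_left this (by positivity))
  obtain ⟨X, hX⟩ := cauchySeq_tendsto_of_complete hcau
  have hmem : X ∈ wspan u (Set.Ici 0) :=
    (isClosed_wspan u _).mem_of_tendsto hX
      (.of_forall fun n => linearCombination_nat_mem_wspan u (x n))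
  -- `B x⁽ⁿ⁾ → y` says that `X` and `Y` have equal inner products with all generators.
  have hXP : (wspan u (Set.Ici 0)).starProjection Y = X := by
    refine Submodule.eq_starProjection_of_mem_orthogonal hmem
      (mem_wspan_orthogonal.2 fun k hk => ?_)
    obtain ⟨k, rfl⟩ := Int.eq_ofNat_of_zero_le (Set.mem_Ici.1 hk)
    have h1 := hx2 k
    simp only [hG.matVec_eq] at h1
    have h2 := tendsto_nhds_unique h1 (tendsto_mul_inner hX _)
    rw [hG.vec] at h2
    rw [inner_sub_right, sub_eq_zero]
    exact mul_left_cancel₀ hpi h2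
  rw [hXP]
  constructor
  · ext j
    have h1 := hx3 j
    simp only [coeff_analyticPoly h] at h1
    exact tendsto_nhds_unique h1 (tendsto_mul_inner hX _)
  · simp only [pairing_eq_inner hG.vec] at hx4
    exact tendsto_nhds_unique hx4 (tendsto_mul_inner_left hX _)

end

/-- A solution in `ℓ₂` of `B x = y`, for a matrix bounded on `ℓ₂`, is an inverse in the sense of
the energy norm. -/
lemma isInverse_of_bounded {B : ℕ → ℕ → ℂ} {y : ℕ → ℂ}
    (T : lp (fun _ : ℕ => ℂ) 2 →L[ℂ] lp (fun _ : ℕ => ℂ) 2)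
    (hT : ∀ (x : lp (fun _ : ℕ => ℂ) 2) (k : ℕ), HasSum (fun j => B k j * x j) (T x k))
    (x : lp (fun _ : ℕ => ℂ) 2) (hx : ∀ k, T x k = y k) :
    IsInverse B y x (inner ℂ x (T x)) := by
  -- Truncations of `x`, viewed both in `ℓ₂` and as finite sequences; boundedness of `T` bounds the
  -- energy by the `ℓ₂` norm.
  let s : ℕ → lp (fun _ : ℕ => ℂ) 2 := fun n => ∑ j ∈ Finset.range n, lp.single 2 j (x j)
  let p : ℕ → (ℕ →₀ ℂ) := fun n => ∑ j ∈ Finset.range n, Finsupp.single j (x j)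
  have hs : Tendsto s atTop (𝓝 x) := (lp.hasSum_single (by simp) x).tendsto_sum_nat
  have hps : ∀ n, ⇑(s n) = ⇑(p n) := fun n => by
    ext k
    simp only [s, p, lp.coeFn_sum, Finset.sum_apply, lp.single_apply, Finsupp.finsetSum_apply]
    refine Finset.sum_congr rfl fun j _ => ?_
    rw [Finsupp.single_apply, Pi.single_apply]
    simp only [eq_comm]
  have hsub : ∀ m n, ⇑(s m - s n) = ⇑(p m - p n) := fun m n => by
    rw [lp.coeFn_sub, hps, hps]; rfl
  have hmat : ∀ z : lp (fun _ : ℕ => ℂ) 2, matVec B z = T z := fun z => by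
    ext k; exact (hT z k).tsum_eq
  have hpair : ∀ z t : lp (fun _ : ℕ => ℂ) 2, pairing z t = inner ℂ t z := fun z t => by
    rw [lp.inner_eq_tsum, pairing]; rfl
  have hy : y = T x := funext fun k => (hx k).symm
  have heval : ∀ k, Tendsto (fun n => T (s n) k) atTop (𝓝 (T x k)) ∧
      Tendsto (fun n => s n k) atTop (𝓝 (x k)) := fun k => by
    have hk : ∀ {z : ℕ → lp (fun _ : ℕ => ℂ) 2} {t : lp (fun _ : ℕ => ℂ) 2},
        Tendsto z atTop (𝓝 t) → Tendsto (fun n => z n k) atTop (𝓝 (t k)) := by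
      intro z t hz
      rw [tendsto_iff_norm_sub_tendsto_zero] at hz ⊢
      exact squeeze_zero (fun _ => norm_nonneg _)
        (fun n => lp.norm_apply_le_norm two_ne_zero (z n - t) k) hz
    exact ⟨hk ((T.continuous.tendsto x).comp hs), hk hs⟩
  refine ⟨p, fun ε hε => ?_, fun k => ?_, fun j => ?_, ?_⟩
  · obtain ⟨N, hN⟩ := Metric.cauchySeq_iff.1 hs.cauchySeq (Real.sqrt (ε / (‖T‖ + 1)))
      (Real.sqrt_pos.2 (by positivity))
    refine ⟨N, fun m hm n hn => ?_⟩
    rw [← hsub, hmat, hpair]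
    have h1 := hN m hm n hn
    rw [dist_eq_norm, Real.lt_sqrt (norm_nonneg _), lt_div_iff₀ (by positivity)] at h1
    calc ‖inner ℂ (s m - s n) (T (s m - s n))‖
        ≤ ‖s m - s n‖ * (‖T‖ * ‖s m - s n‖) := (norm_inner_le_norm _ _).trans
          (mul_le_mul_of_nonneg_left (T.le_opNorm _) (norm_nonneg _))
      _ ≤ ‖s m - s n‖ ^ 2 * (‖T‖ + 1) := by nlinarith [sq_nonneg ‖s m - s n‖]
      _ < ε := h1
  · simp only [← hps, hmat]
    rw [← hx]
    exact (heval k).1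
  · simp only [← hps]
    exact (heval j).2
  · simp only [← hps, hy, hpair]
    exact hs.inner tendsto_const_nhds

/-! ### Fourier coefficients of square integrable functions -/

lemma orthonormal_wex_one :
    Orthonormal ℂ fun j : ℕ => (((Real.sqrt (2 * Real.pi))⁻¹ : ℝ) : ℂ) • wex (fun _ => 1) j := by
  rw [orthonormal_iff_ite]
  intro i j
  rw [inner_smul_left, inner_smul_right, inner_wex_wex isDual_one, Complex.conj_ofReal]
  have h : (Real.sqrt (2 * Real.pi))⁻¹ * ((Real.sqrt (2 * Real.pi))⁻¹ * (2 * Real.pi)) = 1 := by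
    rw [← mul_assoc, ← mul_inv, Real.mul_self_sqrt (by positivity)]
    exact inv_mul_cancel₀ (by positivity)
  by_cases hij : i = j
  · rw [if_pos (by exact_mod_cast hij.symm), if_pos hij, ← Complex.ofReal_mul,
      ← Complex.ofReal_mul, h, Complex.ofReal_one]
  · rw [if_neg (fun hji => hij (Nat.cast_injective hji).symm), if_neg hij, mul_zero, mul_zero]

/-- Bessel's inequality. -/
lemma memℓp_inner_wex_one (x : Lp ℂ 2 circ) (t : ℂ) :
    Memℓp (fun j : ℕ => t * inner ℂ (wex (fun _ => 1) j) x) 2 := by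
  have h := orthonormal_wex_one.inner_products_summable x
  rw [memℓp_gen_iff (by simp)]
  have h2 : Real.sqrt (2 * Real.pi) ≠ 0 := by positivity
  refine (h.mul_left (‖t‖ ^ 2 * (2 * Real.pi))).congr fun j => ?_
  rw [inner_smul_left, Complex.conj_ofReal, norm_mul, norm_mul, Complex.norm_real,
    Real.norm_of_nonneg (by positivity)]
  simp only [ENNReal.toReal_ofNat, Real.rpow_ofNat]
  rw [mul_pow, mul_pow, inv_pow, Real.sq_sqrt (by positivity)]
  have : 2 * Real.pi ≠ 0 := by positivity
  field_simp

/-- The Riesz–Fischer theorem for analytic series. -/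
lemma summable_smul_wex_one {c : ℕ → ℂ} (hc : Memℓp c 2) :
    Summable fun j : ℕ => c j • wex (fun _ => 1) j := by
  have hV := orthonormal_wex_one.orthogonalFamily
  let F : lp (fun _ : ℕ => ℂ) 2 := ⟨c, hc⟩
  have h := (hV.hasSum_linearIsometry F).summable.const_smul ((Real.sqrt (2 * Real.pi) : ℝ) : ℂ)
  refine h.congr fun j => ?_
  have h2 : Real.sqrt (2 * Real.pi) ≠ 0 := by positivity
  simp only [LinearIsometry.toSpanSingleton_apply]
  change ((Real.sqrt (2 * Real.pi) : ℝ) : ℂ) • (c j • (((Real.sqrt (2 * Real.pi))⁻¹ : ℝ) : ℂ) •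
    wex (fun _ => 1) j) = _
  rw [smul_comm (c j), smul_smul, ← Complex.ofReal_mul, mul_inv_cancel₀ h2, Complex.ofReal_one,
    one_smul]

/-! ### Gram matrices of stationary sequences -/

/-- Proportional Gram matrices give proportional geometry. It is used with `t = 1/2π` for spectral
isometries and with `t = 0` for independence. -/
lemma inner_linearCombination {ι E F : Type*} [NormedAddCommGroup E] [InnerProductSpace ℂ E]
    [NormedAddCommGroup F] [InnerProductSpace ℂ F] {x x' : ι → E} {y y' : ι → F} {t : ℂ}
    (h : ∀ i j, inner ℂ (x i) (x' j) = t * inner ℂ (y i) (y' j)) (p q : ι →₀ ℂ) :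
    inner ℂ (Finsupp.linearCombination ℂ x p) (Finsupp.linearCombination ℂ x' q) =
      t * inner ℂ (Finsupp.linearCombination ℂ y p) (Finsupp.linearCombination ℂ y' q) := by
  simp only [Finsupp.linearCombination_apply, Finsupp.sum, sum_inner, inner_sum, Finset.mul_sum]
  refine Finset.sum_congr rfl fun i _ => Finset.sum_congr rfl fun j _ => ?_
  simp only [inner_smul_left, inner_smul_right, h]; ring

lemma norm_sq_linearCombination {ι E F : Type*} [NormedAddCommGroup E] [InnerProductSpace ℂ E]
    [NormedAddCommGroup F] [InnerProductSpace ℂ F] {x : ι → E} {y : ι → F} {t : ℝ}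
    (h : ∀ i j, inner ℂ (x i) (x j) = (t : ℂ) * inner ℂ (y i) (y j)) (p : ι →₀ ℂ) :
    ‖Finsupp.linearCombination ℂ x p‖ ^ 2 = t * ‖Finsupp.linearCombination ℂ y p‖ ^ 2 := by
  have := inner_linearCombination h p p
  rw [inner_self_eq_norm_sq_to_K, inner_self_eq_norm_sq_to_K] at this
  apply Complex.ofReal_injective
  rw [Complex.ofReal_pow, Complex.ofReal_mul, Complex.ofReal_pow]
  exact this

lemma memLp_sqrt {f : ℝ → ℝ} (hf : Integrable f circ) (h0 : ∀ᵐ θ ∂circ, 0 ≤ f θ) :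
    MemLp (fun θ => (Real.sqrt (f θ) : ℂ)) 2 circ := by
  have hm : AEStronglyMeasurable (fun θ => (Real.sqrt (f θ) : ℂ)) circ :=
    (Complex.continuous_ofReal.comp Real.continuous_sqrt).comp_aestronglyMeasurable hf.1
  rw [memLp_two_iff_integrable_sq_norm hm]
  refine hf.congr ?_
  filter_upwards [h0] with θ hθ
  rw [Complex.norm_real, Real.norm_of_nonneg (Real.sqrt_nonneg _), Real.sq_sqrt hθ]

lemma inner_wex_sqrt {f : ℝ → ℝ} (hf : Integrable f circ) (h0 : ∀ᵐ θ ∂circ, 0 ≤ f θ)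
    (m : ℤ) {φ : ℝ → ℂ} (hφ : MemLp (fun θ => φ θ * (Real.sqrt (f θ) : ℂ)) 2 circ) :
    inner ℂ (wex (fun θ => Real.sqrt (f θ)) m) (emb fun θ => φ θ * (Real.sqrt (f θ) : ℂ)) =
      ∫ θ, φ θ * f θ * ex (-m) θ ∂circ := by
  rw [inner_wex_emb (memLp_sqrt hf h0) m hφ]
  refine integral_congr_ae ?_
  filter_upwards [h0] with θ hθ
  rw [mul_assoc (φ θ), ← Complex.ofReal_mul, Real.mul_self_sqrt hθ]

section

variable {Ω : Type*} [MeasurableSpace Ω] {P : Measure Ω} {ξ η : ℤ → Ω → ℂ} {f g : ℝ → ℝ}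

lemma inner_toLp_toLp {X Y : Ω → ℂ} (hX : MemLp X 2 P) (hY : MemLp Y 2 P) :
    inner ℂ (hX.toLp X) (hY.toLp Y) = ∫ ω, Y ω * conj (X ω) ∂P := by
  rw [L2.inner_def]
  refine integral_congr_ae ?_
  filter_upwards [hX.coeFn_toLp, hY.coeFn_toLp] with ω h1 h2
  rw [h1, h2, RCLike.inner_apply]

lemma IsStationary.inner_toL2 (hξ : IsStationary P ξ f) (m n : ℤ) :
    inner ℂ (hξ.toL2 m) (hξ.toL2 n) = ((1 / (2 * Real.pi) : ℝ) : ℂ) *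
      inner ℂ (wex (fun θ => Real.sqrt (f θ)) m) (wex (fun θ => Real.sqrt (f θ)) n) := by
  rw [IsStationary.toL2, IsStationary.toL2, inner_toLp_toLp, hξ.cov, mean]
  congr 1
  rw [wex, wex, ← wex, inner_wex_sqrt hξ.integrable hξ.nonneg m
    (memLp_ex_mul (memLp_sqrt hξ.integrable hξ.nonneg) n)]
  congr 1; ext θ
  rw [sub_eq_add_neg, ex_add]; ring

/-- Independence factors the expectation of the product, and centring makes a factor vanish. -/
lemma inner_toL2_of_indepFun [IsProbabilityMeasure P] (hξ : IsStationary P ξ f)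
    (hη : IsStationary P η g) (hind : IndepFun (fun ω k => ξ k ω) (fun ω k => η k ω) P)
    (m n : ℤ) : inner ℂ (hξ.toL2 m) (hη.toL2 n) = 0 := by
  rw [IsStationary.toL2, IsStationary.toL2, inner_toLp_toLp]
  have h : IndepFun (η n) (fun ω => conj (ξ m ω)) P :=
    (hind.comp (φ := fun x : ℤ → ℂ => conj (x m)) (ψ := fun x : ℤ → ℂ => x n)
      (Complex.continuous_conj.measurable.comp (measurable_pi_apply m))
      (measurable_pi_apply n)).symm
  rw [h.integral_fun_mul_eq_mul_integral (hη.memLp n).1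
    (Complex.continuous_conj.comp_aestronglyMeasurable (hξ.memLp m).1), hη.centred, zero_mul]

lemma inner_toL2_of_indepFun' [IsProbabilityMeasure P] (hξ : IsStationary P ξ f)
    (hη : IsStationary P η g) (hind : IndepFun (fun ω k => ξ k ω) (fun ω k => η k ω) P)
    (m n : ℤ) : inner ℂ (hη.toL2 m) (hξ.toL2 n) = 0 := by
  rw [← inner_conj_symm, inner_toL2_of_indepFun hξ hη hind, map_zero]

lemma memLp_sqrt_add (hξ : IsStationary P ξ f) (hη : IsStationary P η g) :
    MemLp (fun θ => (Real.sqrt (f θ + g θ) : ℂ)) 2 circ :=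
  memLp_sqrt (hξ.integrable.add hη.integrable)
    (by filter_upwards [hξ.nonneg, hη.nonneg] with θ h1 h2 using add_nonneg h1 h2)

lemma inner_observation [IsProbabilityMeasure P] (hξ : IsStationary P ξ f)
    (hη : IsStationary P η g) (hind : IndepFun (fun ω k => ξ k ω) (fun ω k => η k ω) P)
    (m n : ℤ) : inner ℂ (hξ.toL2 m + hη.toL2 m) (hξ.toL2 n + hη.toL2 n) =
      ((1 / (2 * Real.pi) : ℝ) : ℂ) * inner ℂ (wex (fun θ => Real.sqrt (f θ + g θ)) m)
        (wex (fun θ => Real.sqrt (f θ + g θ)) n) := by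
  rw [inner_add_left, inner_add_right, inner_add_right, inner_toL2_of_indepFun hξ hη hind,
    inner_toL2_of_indepFun' hξ hη hind, hξ.inner_toL2, hη.inner_toL2, zero_add, add_zero,
    ← mul_add]
  congr 1
  have h0 : ∀ᵐ θ ∂circ, 0 ≤ f θ + g θ := by
    filter_upwards [hξ.nonneg, hη.nonneg] with θ h1 h2 using add_nonneg h1 h2
  have hi : ∀ {s : ℝ → ℝ}, Integrable s circ →
      Integrable (fun θ => ex n θ * (s θ : ℂ) * ex (-m) θ) circ := fun {s} hs =>
    Integrable.mul_ex ((Integrable.mul_ex hs.ofReal n).congr (.of_forall fun θ => mul_comm _ _)) _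
  have hw : ∀ {s : ℝ → ℝ}, Integrable s circ → (∀ᵐ θ ∂circ, 0 ≤ s θ) →
      inner ℂ (wex (fun θ => Real.sqrt (s θ)) m) (wex (fun θ => Real.sqrt (s θ)) n) =
      ∫ θ, ex n θ * s θ * ex (-m) θ ∂circ := fun {s} hs h0 =>
    inner_wex_sqrt hs h0 m (memLp_ex_mul (memLp_sqrt hs h0) n)
  rw [hw hξ.integrable hξ.nonneg, hw hη.integrable hη.nonneg,
    hw (s := fun θ => f θ + g θ) (hξ.integrable.add hη.integrable) h0,
    ← integral_add (hi hξ.integrable) (hi hη.integrable)]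
  congr 1; ext θ
  push_cast; ring

/-! ### The functional and its estimates -/

/-- The partial sums of a one-sided sequence of coefficients. -/
def initialPoly (a : ℕ → ℂ) (n : ℕ) : ℤ →₀ ℂ :=
  ∑ j ∈ Finset.range n, Finsupp.single (j : ℤ) (a j)

lemma linearCombination_initialPoly {E : Type*} [AddCommGroup E] [Module ℂ E] (x : ℤ → E)
    (a : ℕ → ℂ) (n : ℕ) :
    Finsupp.linearCombination ℂ x (initialPoly a n) = ∑ j ∈ Finset.range n, a j • x j := by
  simp only [initialPoly, map_sum, Finsupp.linearCombination_single]

lemma IsStationary.summable (hξ : IsStationary P ξ f) {a : ℕ → ℂ}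
    (ha : Summable fun j => ‖a j‖) : Summable fun j : ℕ => a j • hξ.toL2 j := by
  have hn : ∀ k, ‖hξ.toL2 k‖ = ‖hξ.toL2 0‖ := fun k => by
    have h : ∀ k, ‖hξ.toL2 k‖ ^ 2 =
        1 / (2 * Real.pi) * ‖wex (fun θ => Real.sqrt (f θ)) 0‖ ^ 2 := fun k => by
      have := norm_sq_linearCombination hξ.inner_toL2 (Finsupp.single k 1)
      rwa [Finsupp.linearCombination_single, Finsupp.linearCombination_single, one_smul, one_smul,
        norm_wex (memLp_sqrt hξ.integrable hξ.nonneg)] at this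
    rw [← Real.sqrt_sq (norm_nonneg (hξ.toL2 k)), ← Real.sqrt_sq (norm_nonneg (hξ.toL2 0)), h, h]
  refine Summable.of_norm ?_
  simp only [norm_smul, hn]
  exact ha.mul_right _

lemma IsStationary.tendsto_functional (hξ : IsStationary P ξ f) {a : ℕ → ℂ}
    (ha : Summable fun j => ‖a j‖) :
    Tendsto (fun n => Finsupp.linearCombination ℂ hξ.toL2 (initialPoly a n)) atTop
      (𝓝 (∑' j : ℕ, a j • hξ.toL2 j)) := by
  simp only [linearCombination_initialPoly]
  exact (hξ.summable ha).hasSum.tendsto_sum_nat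

lemma tendsto_symbolA {a : ℕ → ℂ} (ha : Summable fun j => ‖a j‖) {v : ℝ → ℝ}
    (hv : MemLp (fun θ => (v θ : ℂ)) 2 circ) :
    Tendsto (fun n => Finsupp.linearCombination ℂ (wex v) (initialPoly a n)) atTop
      (𝓝 (emb fun θ => symbolA a θ * (v θ : ℂ))) := by
  simp only [linearCombination_initialPoly]
  exact (hasSum_smul_wex ha hv).tendsto_sum_nat

lemma memLp_mul_of_le {s v : ℝ → ℝ} (hs : AEStronglyMeasurable (fun θ => (s θ : ℂ)) circ)
    (hsv : ∀ᵐ θ ∂circ, |s θ| ≤ |v θ|) {φ : ℝ → ℂ} (hm : AEStronglyMeasurable φ circ)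
    (hφ : MemLp (fun θ => φ θ * (v θ : ℂ)) 2 circ) :
    MemLp (fun θ => φ θ * (s θ : ℂ)) 2 circ := by
  refine hφ.mono (hm.mul hs) ?_
  filter_upwards [hsv] with θ h
  rw [norm_mul, norm_mul, Complex.norm_real, Complex.norm_real]
  exact mul_le_mul_of_nonneg_left h (norm_nonneg _)

/-- Convergence of trigonometric polynomials in a weighted space implies convergence for a smaller
weight. -/
lemma tendsto_of_le {s v : ℝ → ℝ} (hs : MemLp (fun θ => (s θ : ℂ)) 2 circ)
    (hv : MemLp (fun θ => (v θ : ℂ)) 2 circ)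
    (hsv : ∀ᵐ θ ∂circ, |s θ| ≤ |v θ|) {φ : ℝ → ℂ} (hm : AEStronglyMeasurable φ circ)
    (hφ : MemLp (fun θ => φ θ * (v θ : ℂ)) 2 circ) {p : ℕ → (ℤ →₀ ℂ)}
    (hp : Tendsto (fun n => Finsupp.linearCombination ℂ (wex v) (p n)) atTop
      (𝓝 (emb fun θ => φ θ * (v θ : ℂ)))) :
    Tendsto (fun n => Finsupp.linearCombination ℂ (wex s) (p n)) atTop
      (𝓝 (emb fun θ => φ θ * (s θ : ℂ))) := by
  have hφs := memLp_mul_of_le hs.1 hsv hm hφ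
  rw [tendsto_iff_norm_sub_tendsto_zero] at hp ⊢
  refine squeeze_zero (fun _ => norm_nonneg _) (fun n => ?_) hp
  have h1 := memLp_mul (memLp_trigPoly (p n)) hs
  have h2 := memLp_mul (memLp_trigPoly (p n)) hv
  rw [linearCombination_wex hs, linearCombination_wex hv, emb_sub h1 hφs, emb_sub h2 hφ]
  refine Lp.norm_le_norm_of_ae_le ?_
  filter_upwards [coeFn_emb (h1.sub hφs), coeFn_emb (h2.sub hφ), hsv] with θ h3 h4 h5
  simp only [Pi.sub_def] at h3 h4
  rw [h3, h4, ← sub_mul, ← sub_mul, norm_mul, norm_mul, Complex.norm_real, Complex.norm_real]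
  exact mul_le_mul_of_nonneg_left h5 (norm_nonneg _)

/-- The spectral representation of an element of the span of the observations: its mean square
distance to the functional, and its correlation with the observations. -/
lemma exists_spectralIntegral [IsProbabilityMeasure P] (hξ : IsStationary P ξ f)
    (hη : IsStationary P η g) (hind : IndepFun (fun ω k => ξ k ω) (fun ω k => η k ω) P)
    {a : ℕ → ℂ} (ha : Summable fun j => ‖a j‖) {h : ℝ → ℂ} (hm : AEStronglyMeasurable h circ)
    (hh : MemLp (fun θ => h θ * (Real.sqrt (f θ + g θ) : ℂ)) 2 circ) {p : ℕ → (ℤ →₀ ℂ)}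
    (hp : Tendsto
      (fun n => Finsupp.linearCombination ℂ (wex fun θ => Real.sqrt (f θ + g θ)) (p n)) atTop
      (𝓝 (emb fun θ => h θ * (Real.sqrt (f θ + g θ) : ℂ)))) :
    ∃ X : Lp ℂ 2 P,
      Tendsto (fun n => Finsupp.linearCombination ℂ (fun k => hξ.toL2 k + hη.toL2 k) (p n)) atTop
        (𝓝 X) ∧
      ‖(∑' j : ℕ, a j • hξ.toL2 j) - X‖ ^ 2 =
        1 / (2 * Real.pi) * (‖(emb fun θ => symbolA a θ * (Real.sqrt (f θ) : ℂ)) -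
          emb fun θ => h θ * (Real.sqrt (f θ) : ℂ)‖ ^ 2 +
          ‖emb fun θ => h θ * (Real.sqrt (g θ) : ℂ)‖ ^ 2) ∧
      ∀ k : ℤ, inner ℂ (hξ.toL2 k + hη.toL2 k) ((∑' j : ℕ, a j • hξ.toL2 j) - X) =
        ((1 / (2 * Real.pi) : ℝ) : ℂ) * (∫ θ, symbolA a θ * f θ * ex (-k) θ ∂circ -
          ∫ θ, h θ * (f θ + g θ : ℝ) * ex (-k) θ ∂circ) := by
  set ζ : ℤ → Lp ℂ 2 P := fun k => hξ.toL2 k + hη.toL2 k with hζ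
  set v : ℝ → ℝ := fun θ => Real.sqrt (f θ + g θ) with hvdef
  have hv : MemLp (fun θ => (v θ : ℂ)) 2 circ := memLp_sqrt_add hξ hη
  have hsf := memLp_sqrt hξ.integrable hξ.nonneg
  have hsg := memLp_sqrt hη.integrable hη.nonneg
  have hw : ∀ᵐ θ ∂circ, 0 ≤ f θ + g θ := by
    filter_upwards [hξ.nonneg, hη.nonneg] with θ h1 h2 using add_nonneg h1 h2
  have hgram : ∀ m n, inner ℂ (ζ m) (ζ n) =
      ((1 / (2 * Real.pi) : ℝ) : ℂ) * inner ℂ (wex v m) (wex v n) :=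
    inner_observation hξ hη hind
  -- The spectral isometry transfers the Cauchy property from `L²` to the observations.
  have hcau : CauchySeq fun n => Finsupp.linearCombination ℂ ζ (p n) := by
    refine Metric.cauchySeq_iff.2 fun ε hε => ?_
    obtain ⟨N, hN⟩ := Metric.cauchySeq_iff.1 hp.cauchySeq (ε * Real.sqrt (2 * Real.pi))
      (by positivity)
    refine ⟨N, fun m hm n hn => ?_⟩
    have h1 := hN m hm n hn
    rw [dist_eq_norm, ← map_sub] at h1 ⊢
    have h2 := norm_sq_linearCombination hgram (p m - p n)
    have h3 : ‖Finsupp.linearCombination ℂ (wex v) (p m - p n)‖ ^ 2 <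
        (ε * Real.sqrt (2 * Real.pi)) ^ 2 :=
      pow_lt_pow_left₀ h1 (norm_nonneg _) two_ne_zero
    rw [mul_pow, Real.sq_sqrt (by positivity)] at h3
    refine lt_of_pow_lt_pow_left₀ 2 hε.le ?_
    rw [h2, one_div_mul_eq_div, div_lt_iff₀ (by positivity)]
    exact h3
  obtain ⟨X, hX⟩ := cauchySeq_tendsto_of_complete hcau
  have hle_f : ∀ᵐ θ ∂circ, |Real.sqrt (f θ)| ≤ |v θ| := by
    filter_upwards [hη.nonneg] with θ h1
    rw [abs_of_nonneg (Real.sqrt_nonneg _), abs_of_nonneg (Real.sqrt_nonneg _)]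
    exact Real.sqrt_le_sqrt (by linarith)
  have hle_g : ∀ᵐ θ ∂circ, |Real.sqrt (g θ)| ≤ |v θ| := by
    filter_upwards [hξ.nonneg] with θ h1
    rw [abs_of_nonneg (Real.sqrt_nonneg _), abs_of_nonneg (Real.sqrt_nonneg _)]
    exact Real.sqrt_le_sqrt (by linarith)
  have hpf := tendsto_of_le hsf hv hle_f hm hh hp
  have hpg := tendsto_of_le hsg hv hle_g hm hh hp
  have hA := hξ.tendsto_functional ha
  have hAf := tendsto_symbolA ha hsf
  refine ⟨X, hX, ?_, fun k => ?_⟩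
  · have h1 := ((hA.sub hX).norm.pow 2)
    refine tendsto_nhds_unique h1 ?_
    have h2 := (((hAf.sub hpf).norm.pow 2).add (hpg.norm.pow 2)).const_mul (1 / (2 * Real.pi))
    refine h2.congr fun n => ?_
    -- The error is a combination of the `ξ_k` minus one of the `η_k`; these are orthogonal, so
    -- their squared norms add.
    have hsplit : Finsupp.linearCombination ℂ ζ (p n) =
        Finsupp.linearCombination ℂ hξ.toL2 (p n) +
        Finsupp.linearCombination ℂ hη.toL2 (p n) := by
      simp only [hζ, Finsupp.linearCombination_apply, smul_add, Finsupp.sum_add]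
    have horth : inner ℂ (Finsupp.linearCombination ℂ hξ.toL2 (initialPoly a n - p n))
        (Finsupp.linearCombination ℂ hη.toL2 (p n)) = 0 := by
      have := inner_linearCombination (x := hξ.toL2) (x' := hη.toL2) (y := hξ.toL2)
        (y' := hη.toL2) (t := 0) (fun i j => by
          rw [inner_toL2_of_indepFun hξ hη hind, zero_mul]) (initialPoly a n - p n) (p n)
      rw [this, zero_mul]
    rw [hsplit, ← sub_sub, ← map_sub, ← map_sub,
      norm_sub_sq (𝕜 := ℂ), horth, norm_sq_linearCombination hξ.inner_toL2,
      norm_sq_linearCombination hη.inner_toL2, map_zero]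
    ring
  · rw [inner_sub_right, mul_sub]
    congr 1
    · have h1 : Tendsto (fun n => inner ℂ (ζ k)
          (Finsupp.linearCombination ℂ hξ.toL2 (initialPoly a n))) atTop
          (𝓝 (inner ℂ (ζ k) (∑' j : ℕ, a j • hξ.toL2 j))) := tendsto_const_nhds.inner hA
      refine tendsto_nhds_unique h1 ?_
      rw [← inner_wex_sqrt hξ.integrable hξ.nonneg k (memLp_mul (memLp_symbolA ha) hsf)]
      refine (tendsto_mul_inner hAf _).congr fun n => ?_
      have := inner_linearCombination (x := ζ) (x' := hξ.toL2)
        (y := wex fun θ => Real.sqrt (f θ)) (y' := wex fun θ => Real.sqrt (f θ))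
        (t := ((1 / (2 * Real.pi) : ℝ) : ℂ)) (fun i j => by
          rw [hζ, inner_add_left, inner_toL2_of_indepFun' hξ hη hind, add_zero, hξ.inner_toL2])
        (Finsupp.single k 1) (initialPoly a n)
      rw [Finsupp.linearCombination_single, Finsupp.linearCombination_single, one_smul,
        one_smul] at this
      exact this.symm
    · have h1 : Tendsto (fun n => inner ℂ (ζ k) (Finsupp.linearCombination ℂ ζ (p n))) atTop
          (𝓝 (inner ℂ (ζ k) X)) := tendsto_const_nhds.inner hX
      refine tendsto_nhds_unique h1 ?_
      rw [← inner_wex_sqrt (f := fun θ => f θ + g θ) (hξ.integrable.add hη.integrable) hw k hh]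
      refine (tendsto_mul_inner hp _).congr fun n => ?_
      have := inner_linearCombination hgram (Finsupp.single k 1) (p n)
      rw [Finsupp.linearCombination_single, Finsupp.linearCombination_single, one_smul,
        one_smul] at this
      exact this.symm

end

/-! ### Toeplitz matrices and Fourier sums -/

lemma matVec_toeplitz {a : ℕ → ℂ} (ha : Summable fun j => ‖a j‖) {s : ℝ → ℝ}
    (hs : Integrable s circ) (k : ℕ) :
    matVec (toeplitz s) a k =
      ((1 / (2 * Real.pi) : ℝ) : ℂ) * ∫ θ, symbolA a θ * s θ * ex (-(k : ℤ)) θ ∂circ := by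
  have hs' : Integrable (fun θ => (s θ : ℂ)) circ := hs.ofReal
  have h := (hasSum_integral_symbolA ha (Integrable.mul_ex hs' (-(k : ℤ)))).mul_left
    ((1 / (2 * Real.pi) : ℝ) : ℂ)
  simp only [← mul_assoc] at h
  refine Eq.trans ?_ h.tsum_eq
  rw [matVec]
  congr 1; ext j
  rw [toeplitz, mean, mul_assoc, mul_comm (∫ θ, _ ∂circ), ← mul_assoc]
  congr 2; ext θ
  rw [sub_eq_add_neg, ex_add]; ring

lemma pairing_toeplitz {a : ℕ → ℂ} (ha : Summable fun j => ‖a j‖) {s : ℝ → ℝ}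
    (hs : Integrable s circ) :
    pairing (matVec (toeplitz s) a) a =
      ((1 / (2 * Real.pi) * ∫ θ, ‖symbolA a θ‖ ^ 2 * s θ ∂circ : ℝ) : ℂ) := by
  have hi : Integrable (fun θ => conj (symbolA a θ) * (s θ : ℂ)) circ :=
    hs.ofReal.bdd_mul (c := ∑' j, ‖a j‖) (memLp_symbolA ha).star.1
      (.of_forall fun _ => (RCLike.norm_conj _).trans_le (norm_symbolA_le ha _))
  have h := (hasSum_integral_symbolA ha hi).star.mul_left ((1 / (2 * Real.pi) : ℝ) : ℂ)
  have h2 : (∫ θ, symbolA a θ * (conj (symbolA a θ) * (s θ : ℂ)) ∂circ) =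
      ((∫ θ, ‖symbolA a θ‖ ^ 2 * s θ ∂circ : ℝ) : ℂ) := by
    rw [← integral_complex_ofReal]
    congr 1; ext θ
    rw [← mul_assoc, Complex.mul_conj, Complex.normSq_eq_norm_sq]; push_cast; ring
  rw [h2, RCLike.star_def, Complex.conj_ofReal, ← Complex.ofReal_mul] at h
  rw [pairing, ← h.tsum_eq]
  congr 1; ext k
  rw [matVec_toeplitz ha hs, map_mul, ← integral_conj, mul_assoc,
    mul_comm (∫ θ, _ ∂circ)]
  congr 3; ext θ
  simp only [map_mul, conj_ex, Complex.conj_conj, Complex.conj_ofReal]; ring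

lemma IsFourierSum.unique {c : ℕ → ℂ} {C C' : ℝ → ℂ} (h : IsFourierSum c C)
    (h' : IsFourierSum c C') : C' =ᵐ[circ] C := by
  have hpi : ((1 / (2 * Real.pi) : ℝ) : ℂ) ≠ 0 := by
    have : (1 / (2 * Real.pi) : ℝ) ≠ 0 := by positivity
    exact_mod_cast this
  have heq : ∀ k, fourierCoef C' k = fourierCoef C k := fun k => by
    rcases lt_or_ge k 0 with hk | hk
    · rw [h.2.2 k hk, h'.2.2 k hk]
    · obtain ⟨j, rfl⟩ := Int.eq_ofNat_of_zero_le hk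
      rw [h.2.1 j, h'.2.1 j]
  have := ae_eq_zero_of_integral_ex (h'.1.sub h.1) fun k => by
    have h1 := mul_left_cancel₀ hpi (heq (-k))
    simp only [neg_neg] at h1
    simp only [Pi.sub_apply, sub_mul]
    rw [integral_sub (Integrable.mul_ex h'.1 k) (Integrable.mul_ex h.1 k), h1, sub_self]
  filter_upwards [this] with θ hθ
  exact sub_eq_zero.1 hθ

/-- Multiplying by `v` turns inner products with `wex v k` into Fourier coefficients;
biorthogonality to the generators kills the negative ones. -/
lemma isFourierSum_of_mem_wspan {v u : ℝ → ℝ} (h : IsDual v u) {x : Lp ℂ 2 circ}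
    (hx : x ∈ wspan u (Set.Ici 0)) :
    IsFourierSum (fun j : ℕ => ((1 / (2 * Real.pi) : ℝ) : ℂ) * inner ℂ (wex v j) x)
      (fun θ => x θ * (v θ : ℂ)) := by
  refine ⟨(Lp.memLp x).integrable_mul h.left, fun j => ?_, fun k hk => ?_⟩
  · simp only [fourierCoef, mean, inner_wex h.left]
  · rw [fourierCoef, mean, ← inner_wex h.left, inner_eq_zero_of_mem_wspan (fun i hi => ?_) hx,
      mul_zero]
    rw [inner_wex_wex h.symm, if_neg]
    have := Set.mem_Ici.1 hi; omega

lemma trigPoly_initialPoly (c : ℕ → ℂ) (n : ℕ) (θ : ℝ) :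
    trigPoly (initialPoly c n) θ = ∑ j ∈ Finset.range n, c j * ex j θ := by
  induction n with
  | zero => simp [initialPoly, trigPoly]
  | succ n ih =>
    rw [initialPoly, Finset.sum_range_succ, trigPoly_add, trigPoly_single, ← initialPoly, ih,
      Finset.sum_range_succ]

/-- An analytic series with square summable coefficients converges in `L²`. -/
lemma IsFourierSum.hasSum {c : ℕ → ℂ} {C : ℝ → ℂ} (hC : IsFourierSum c C) (hc : Memℓp c 2) :
    MemLp C 2 circ ∧ HasSum (fun j : ℕ => c j • wex (fun _ => 1) j) (emb C) := by
  have hs := summable_smul_wex_one hc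
  set S := ∑' j : ℕ, c j • wex (fun _ => 1) j with hS
  have hmem : S ∈ wspan (fun _ => 1) (Set.Ici 0) :=
    (isClosed_wspan _ _).mem_of_tendsto hs.hasSum.tendsto_sum_nat (.of_forall fun n =>
      Submodule.sum_mem _ fun j _ => Submodule.smul_mem _ _
        (wex_mem_wspan _ (Set.mem_Ici.2 (Int.natCast_nonneg j))))
  have hcoef : ∀ j : ℕ, ((1 / (2 * Real.pi) : ℝ) : ℂ) * inner ℂ (wex (fun _ => 1) j) S = c j := by
    intro j
    have h1 : HasSum (fun i : ℕ => inner ℂ (wex (fun _ => 1) j) (c i • wex (fun _ => 1) i))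
        (inner ℂ (wex (fun _ => 1) j) S) := hs.hasSum.mapL (innerSL ℂ _)
    have h2 := hasSum_single (f := fun i : ℕ =>
      inner ℂ (wex (fun _ => 1) j) (c i • wex (fun _ => 1) i)) j fun i hi => by
        rw [inner_smul_right, inner_wex_wex isDual_one, if_neg (by exact_mod_cast hi), mul_zero]
    rw [h1.unique h2, inner_smul_right, inner_wex_wex isDual_one, if_pos rfl, mul_comm (c j),
      ← mul_assoc, ← Complex.ofReal_mul, one_div_mul_cancel (by positivity), Complex.ofReal_one,
      one_mul]
  have hF := isFourierSum_of_mem_wspan isDual_one hmem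
  simp only [hcoef, Complex.ofReal_one, mul_one] at hF
  have hae : S =ᵐ[circ] C := hC.unique hF
  refine ⟨(memLp_congr_ae hae).1 (Lp.memLp S), ?_⟩
  rw [← emb_congr hae, emb_coeFn]
  exact hs.hasSum

/-! ### The observation weight -/

section

variable {f g : ℝ → ℝ}

lemma isDual_sqrt (hf : Integrable f circ) (hg : Integrable g circ)
    (hf0 : ∀ᵐ θ ∂circ, 0 < f θ) (hg0 : ∀ᵐ θ ∂circ, 0 < g θ)
    (hmin : Integrable (fun θ => (f θ + g θ)⁻¹) circ) :
    IsDual (fun θ => Real.sqrt (f θ + g θ)) fun θ => Real.sqrt ((f θ + g θ)⁻¹) where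
  left := memLp_sqrt (hf.add hg) (by
    filter_upwards [hf0, hg0] with θ h1 h2 using (add_pos h1 h2).le)
  right := memLp_sqrt hmin (by
    filter_upwards [hf0, hg0] with θ h1 h2 using (inv_pos.2 (add_pos h1 h2)).le)
  mul := by
    filter_upwards [hf0, hg0] with θ h1 h2
    rw [← Complex.ofReal_mul, ← Real.sqrt_mul (add_pos h1 h2).le,
      mul_inv_cancel₀ (add_pos h1 h2).ne', Real.sqrt_one, Complex.ofReal_one]

lemma memLp_ratio (hf : Integrable f circ) (hg : Integrable g circ)
    (hf0 : ∀ᵐ θ ∂circ, 0 < f θ) (hg0 : ∀ᵐ θ ∂circ, 0 < g θ) :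
    MemLp (fun θ => ((f θ / (f θ + g θ) : ℝ) : ℂ)) ∞ circ := by
  refine memLp_top_of_bound ?_ 1 ?_
  · exact Complex.continuous_ofReal.comp_aestronglyMeasurable
      (hf.1.aemeasurable.div (hf.1.aemeasurable.add hg.1.aemeasurable)).aestronglyMeasurable
  · filter_upwards [hf0, hg0] with θ h1 h2
    rw [Complex.norm_real, Real.norm_of_nonneg (div_pos h1 (add_pos h1 h2)).le,
      div_le_one (add_pos h1 h2)]
    linarith

lemma memLp_symbolA_mul_ratio {a : ℕ → ℂ} (ha : Summable fun j => ‖a j‖)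
    (hf : Integrable f circ) (hg : Integrable g circ)
    (hf0 : ∀ᵐ θ ∂circ, 0 < f θ) (hg0 : ∀ᵐ θ ∂circ, 0 < g θ) :
    MemLp (fun θ => symbolA a θ * ((f θ / (f θ + g θ) : ℝ) : ℂ)) 2 circ :=
  memLp_mul (memLp_symbolA ha) (memLp_two_of_top (memLp_ratio hf hg hf0 hg0))

lemma sqrt_inv_mul_self {w : ℝ} (hw : 0 < w) :
    (Real.sqrt w⁻¹ : ℂ) * (Real.sqrt w⁻¹ : ℂ) = ((w⁻¹ : ℝ) : ℂ) := by
  rw [← Complex.ofReal_mul, Real.mul_self_sqrt (inv_pos.2 hw).le]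

lemma memLp_target {a : ℕ → ℂ} (ha : Summable fun j => ‖a j‖)
    (hf : Integrable f circ) (hg : Integrable g circ)
    (hf0 : ∀ᵐ θ ∂circ, 0 < f θ) (hg0 : ∀ᵐ θ ∂circ, 0 < g θ)
    (hmin : Integrable (fun θ => (f θ + g θ)⁻¹) circ) :
    MemLp (fun θ => symbolA a θ * (f θ * Real.sqrt ((f θ + g θ)⁻¹) : ℝ)) 2 circ := by
  have hd := isDual_sqrt hf hg hf0 hg0 hmin
  refine memLp_mul (memLp_symbolA ha) (hd.left.mono ?_ ?_)
  · simp only [Complex.ofReal_mul]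
    exact hf.ofReal.1.mul hd.right.1
  · filter_upwards [hf0, hg0] with θ h1 h2
    have hw := add_pos h1 h2
    rw [Complex.norm_real, Complex.norm_real, Real.norm_of_nonneg (by positivity),
      Real.norm_of_nonneg (by positivity), Real.sqrt_inv, ← div_eq_mul_inv,
      div_le_iff₀ (Real.sqrt_pos.2 hw), Real.mul_self_sqrt hw.le]
    linarith

/-- The element of `L²` that represents `A f` in the space with weight `1 / (f + g)`. -/
def target (a : ℕ → ℂ) (f g : ℝ → ℝ) : Lp ℂ 2 circ :=
  emb fun θ => symbolA a θ * (f θ * Real.sqrt ((f θ + g θ)⁻¹) : ℝ)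

lemma isGram_target {a : ℕ → ℂ} (ha : Summable fun j => ‖a j‖)
    (hf : Integrable f circ) (hg : Integrable g circ)
    (hf0 : ∀ᵐ θ ∂circ, 0 < f θ) (hg0 : ∀ᵐ θ ∂circ, 0 < g θ)
    (hmin : Integrable (fun θ => (f θ + g θ)⁻¹) circ) :
    IsGram (fun θ => Real.sqrt ((f θ + g θ)⁻¹)) (toeplitz fun θ => (f θ + g θ)⁻¹)
      (target a f g) (matVec (toeplitz fun θ => f θ / (f θ + g θ)) a) where
  mat k j := by
    have hd := isDual_sqrt hf hg hf0 hg0 hmin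
    rw [toeplitz, mean]
    congr 1
    rw [wex, wex, ← wex, inner_wex_emb hd.right _ (memLp_ex_mul hd.right _)]
    refine integral_congr_ae ?_
    filter_upwards [hf0, hg0] with θ h1 h2
    rw [← sqrt_inv_mul_self (add_pos h1 h2), sub_eq_add_neg, ex_add]; ring
  vec k := by
    have hd := isDual_sqrt hf hg hf0 hg0 hmin
    have hi : Integrable (fun θ => f θ / (f θ + g θ)) circ := by
      exact ((memLp_two_of_top (memLp_ratio hf hg hf0 hg0)).integrable one_le_two).re
    rw [matVec_toeplitz ha hi, target, inner_wex_emb hd.right _ (memLp_target ha hf hg hf0 hg0 hmin)]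
    congr 1
    refine integral_congr_ae ?_
    filter_upwards [hf0, hg0] with θ h1 h2
    rw [div_eq_mul_inv, Complex.ofReal_mul, Complex.ofReal_mul,
      ← sqrt_inv_mul_self (add_pos h1 h2)]
    ring

/-- The pointwise decomposition of the mean square error. -/
lemma error_identity (A C : ℂ) {s t : ℝ} (hs : 0 < s) (ht : 0 < t) :
    ‖A * t + C‖ ^ 2 / (s + t) ^ 2 * s + ‖A * s - C‖ ^ 2 / (s + t) ^ 2 * t =
      ‖A‖ ^ 2 * (s * t / (s + t)) + ‖C‖ ^ 2 / (s + t) := by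
  have h1 : s + t ≠ 0 := (add_pos hs ht).ne'
  simp only [← Complex.normSq_eq_norm_sq, Complex.normSq_apply, Complex.add_re, Complex.add_im,
    Complex.sub_re, Complex.sub_im, Complex.mul_re, Complex.mul_im, Complex.ofReal_re,
    Complex.ofReal_im]
  field_simp
  ring

end

/-! ### The spectral characteristic and the optimal estimate -/

section

variable {Ω : Type*} [MeasurableSpace Ω] {P : Measure Ω} {ξ η : ℤ → Ω → ℂ} {f g : ℝ → ℝ}
  {a : ℕ → ℂ}

lemma mem_past_of_tendsto {ζ : ℤ → Lp ℂ 2 P} {p : ℕ → (ℤ →₀ ℂ)}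
    (hp : ∀ n, ∀ k ∈ (p n).support, k ∈ Set.Iio 0) {X : Lp ℂ 2 P}
    (hX : Tendsto (fun n => Finsupp.linearCombination ℂ ζ (p n)) atTop (𝓝 X)) : X ∈ past ζ :=
  mem_closure_of_tendsto hX (.of_forall fun n =>
    (Finsupp.mem_span_image_iff_linearCombination ℂ).2
      ⟨p n, (Finsupp.mem_supported ℂ _).2 (hp n), rfl⟩)

/-- The normal equations: orthogonality to each generator passes to the closed span. -/
lemma optimalEstimate_eq {ζ : ℤ → Lp ℂ 2 P} {X Y : Lp ℂ 2 P} (hX : X ∈ past ζ)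
    (h : ∀ k : ℤ, k < 0 → inner ℂ (ζ k) (Y - X) = 0) : optimalEstimate ζ Y = X := by
  refine Submodule.eq_starProjection_of_mem_of_inner_eq_zero hX fun z hz => ?_
  have hle : past ζ ≤ LinearMap.ker (innerSL ℂ (Y - X)).toLinearMap := by
    refine Submodule.topologicalClosure_minimal _ (Submodule.span_le.2 ?_)
      (innerSL ℂ (Y - X)).isClosed_ker
    rintro _ ⟨k, hk, rfl⟩
    change inner ℂ (Y - X) (ζ k) = 0
    rw [← inner_conj_symm, h k hk, map_zero]
  exact hle hz

/-- Spectral integrals of the observations are determined by their spectral characteristics, and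
conversely. -/
lemma isSpectralIntegral_iff [IsProbabilityMeasure P] (hξ : IsStationary P ξ f)
    (hη : IsStationary P η g) (hind : IndepFun (fun ω k => ξ k ω) (fun ω k => η k ω) P)
    (hf0 : ∀ᵐ θ ∂circ, 0 < f θ) (hg0 : ∀ᵐ θ ∂circ, 0 < g θ) {h₀ : ℝ → ℂ}
    (hm : AEStronglyMeasurable h₀ circ)
    (hh : MemLp (fun θ => h₀ θ * (Real.sqrt (f θ + g θ) : ℂ)) 2 circ) {p : ℕ → (ℤ →₀ ℂ)}
    (hp : Tendsto
      (fun n => Finsupp.linearCombination ℂ (wex fun θ => Real.sqrt (f θ + g θ)) (p n)) atTop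
      (𝓝 (emb fun θ => h₀ θ * (Real.sqrt (f θ + g θ) : ℂ)))) {X : Lp ℂ 2 P}
    (hX : Tendsto (fun n => Finsupp.linearCombination ℂ (fun k => hξ.toL2 k + hη.toL2 k) (p n))
      atTop (𝓝 X)) (h : ℝ → ℂ) :
    IsSpectralIntegral (fun k => hξ.toL2 k + hη.toL2 k) (fun θ => f θ + g θ) h X ↔
      h =ᵐ[circ] h₀ := by
  have hv := memLp_sqrt_add hξ hη
  have hw : ∀ᵐ θ ∂circ, f θ + g θ = Real.sqrt (f θ + g θ) ^ 2 := by
    filter_upwards [hf0, hg0] with θ h1 h2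
    rw [Real.sq_sqrt (add_pos h1 h2).le]
  constructor
  · rintro ⟨hm', q, hq, hqX⟩
    rw [tendsto_sqDist_iff hw hv hm'] at hq
    obtain ⟨hh', hq⟩ := hq
    have h1 : Tendsto (fun n => Finsupp.linearCombination ℂ
        (fun k => hξ.toL2 k + hη.toL2 k) (q n - p n)) atTop (𝓝 0) := by
      simp only [map_sub]
      have := hqX.sub hX
      rwa [sub_self] at this
    -- The isometry read backwards: equal limits in `L²(P)` force equal limits in the weighted
    -- space.
    have h2 : Tendsto (fun n => Finsupp.linearCombination ℂ
        (wex fun θ => Real.sqrt (f θ + g θ)) (q n - p n)) atTop (𝓝 0) := by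
      have h3 := ((h1.norm.pow 2).const_mul (2 * Real.pi)).sqrt
      simp only [norm_sq_linearCombination (inner_observation hξ hη hind), norm_zero] at h3
      rw [tendsto_zero_iff_norm_tendsto_zero]
      have h4 : ∀ t : ℝ, 2 * Real.pi * (1 / (2 * Real.pi) * t ^ 2) = t ^ 2 := fun t => by
        field_simp
      simp only [h4, Real.sqrt_sq (norm_nonneg _)] at h3
      simpa using h3
    have h5 : (emb fun θ => h θ * (Real.sqrt (f θ + g θ) : ℂ)) =
        emb fun θ => h₀ θ * (Real.sqrt (f θ + g θ) : ℂ) := by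
      simp only [map_sub] at h2
      exact sub_eq_zero.1 (tendsto_nhds_unique (hq.sub hp) h2)
    have h6 := (coeFn_emb hh').symm.trans ((Lp.ext_iff.1 h5).trans (coeFn_emb hh))
    filter_upwards [h6, hf0, hg0] with θ h7 h8 h9
    have : (Real.sqrt (f θ + g θ) : ℂ) ≠ 0 := by
      exact_mod_cast (Real.sqrt_pos.2 (add_pos h8 h9)).ne'
    exact mul_right_cancel₀ this h7
  · intro hae
    have h1 : (fun θ => h θ * (Real.sqrt (f θ + g θ) : ℂ)) =ᵐ[circ]
        fun θ => h₀ θ * (Real.sqrt (f θ + g θ) : ℂ) := by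
      filter_upwards [hae] with θ hθ; rw [hθ]
    have hm' := hm.congr hae.symm
    refine ⟨hm', p, (tendsto_sqDist_iff hw hv hm' p).2 ⟨(memLp_congr_ae h1).2 hh, ?_⟩, hX⟩
    rwa [emb_congr h1]

end

end Extrapolation

end

/-! ### The optimal estimate, its error and the agreement with `ℓ₂` -/

open Extrapolation in
theorem theorem2 {Ω : Type*} [MeasurableSpace Ω] (P : Measure Ω) [IsProbabilityMeasure P]
    (ξ η : ℤ → Ω → ℂ) (f g : ℝ → ℝ) (a : ℕ → ℂ)
    (hξ : IsStationary P ξ f) (hη : IsStationary P η g)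
    (hind : IndepFun (fun ω k => ξ k ω) (fun ω k => η k ω) P)
    (hf : ∀ᵐ θ ∂circ, 0 < f θ) (hg : ∀ᵐ θ ∂circ, 0 < g θ)
    (hmin : Integrable (fun θ => (f θ + g θ)⁻¹) circ)
    (ha : Summable fun j => ‖a j‖)
    (ha' : Summable fun j : ℕ => ((j : ℝ) + 1) * ‖a j‖ ^ 2) :
    let w : ℝ → ℝ := fun θ => f θ + g θ
    let B := toeplitz fun θ => (f θ + g θ)⁻¹
    let R := toeplitz fun θ => f θ / (f θ + g θ)
    let Q := toeplitz fun θ => f θ * g θ / (f θ + g θ)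
    let A : ℝ → ℂ := symbolA a
    let Ra : ℕ → ℂ := matVec R a
    let ζ : ℤ → Lp ℂ 2 P := fun k => hξ.toL2 k + hη.toL2 k
    let Aξ : Lp ℂ 2 P := ∑' j : ℕ, a j • hξ.toL2 j
    let est : Lp ℂ 2 P := optimalEstimate ζ Aξ
    -- the functional is well defined, and `Ra ∈ ℓ₂`
    Summable (fun j : ℕ => a j • hξ.toL2 j) ∧ Memℓp Ra 2 ∧
    ∃ (c : ℕ → ℂ) (e : ℂ) (C : ℝ → ℂ),
      -- `c = B⁻¹ R a`, `e = ⟨R a, B⁻¹ R a⟩`, `C = ∑ c_j e^{ijθ}`, all well defined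
      IsInverse B Ra c e ∧ (∀ c' e', IsInverse B Ra c' e' → c' = c ∧ e' = e) ∧
      IsFourierSum c C ∧ (∀ C', IsFourierSum c C' → C' =ᵐ[circ] C) ∧
      -- the spectral characteristic of the optimal estimate
      (∀ h : ℝ → ℂ, IsSpectralIntegral ζ w h est ↔
        h =ᵐ[circ] fun θ => (A θ * f θ - C θ) / (f θ + g θ)) ∧
      ((fun θ => (A θ * f θ - C θ) / (f θ + g θ)) =ᵐ[circ]
        fun θ => A θ - (A θ * g θ + C θ) / (f θ + g θ)) ∧
      MemClosedSpan (Set.Iio 0) w (fun θ => (A θ * f θ - C θ) / (f θ + g θ)) ∧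
      -- the mean square error
      Integrable (fun θ => ‖A θ * g θ + C θ‖ ^ 2 / (f θ + g θ) ^ 2 * f θ) circ ∧
      Integrable (fun θ => ‖A θ * f θ - C θ‖ ^ 2 / (f θ + g θ) ^ 2 * g θ) circ ∧
      ‖Aξ - est‖ ^ 2 =
        1 / (2 * Real.pi) * ∫ θ, ‖A θ * g θ + C θ‖ ^ 2 / (f θ + g θ) ^ 2 * f θ ∂circ +
        1 / (2 * Real.pi) * ∫ θ, ‖A θ * f θ - C θ‖ ^ 2 / (f θ + g θ) ^ 2 * g θ ∂circ ∧
      ((‖Aξ - est‖ ^ 2 : ℝ) : ℂ) = e + pairing (matVec Q a) a ∧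
      -- agreement with the inverse, the series and the inner product of `ℓ₂`
      (∀ T : lp (fun _ : ℕ => ℂ) 2 →L[ℂ] lp (fun _ : ℕ => ℂ) 2,
        (∀ (x : lp (fun _ : ℕ => ℂ) 2) (k : ℕ), HasSum (fun j => B k j * x j) (T x k)) →
        ∀ x : lp (fun _ : ℕ => ℂ) 2, (∀ k, T x k = Ra k) → ∀ j, x j = c j) ∧
      ((∃ K : ℝ, ∀ᵐ θ ∂circ, f θ + g θ ≤ K) → Memℓp c 2) ∧
      (Memℓp c 2 →
        HasSum (fun k => Ra k * conj (c k)) e ∧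
        Tendsto (fun n => sqDist (fun _ => 1) fun θ =>
          C θ - ∑ j ∈ Finset.range n, c j * ex j θ) atTop (𝓝 0)) := by
  intro w B R Q A Ra ζ Aξ est
  have hfi := hξ.integrable
  have hgi := hη.integrable
  set v : ℝ → ℝ := fun θ => Real.sqrt (f θ + g θ) with hv
  set u : ℝ → ℝ := fun θ => Real.sqrt ((f θ + g θ)⁻¹) with hu
  have hd : IsDual v u := isDual_sqrt hfi hgi hf hg hmin
  have hG : IsGram u B (target a f g) Ra := isGram_target ha hfi hgi hf hg hmin
  have hvv : ∀ᵐ θ ∂circ, (v θ : ℂ) * v θ = f θ + g θ := by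
    filter_upwards [hf, hg] with θ h1 h2
    rw [← Complex.ofReal_mul, Real.mul_self_sqrt (add_pos h1 h2).le, Complex.ofReal_add]
  have hw : ∀ᵐ θ ∂circ, w θ = v θ ^ 2 := by
    filter_upwards [hf, hg] with θ h1 h2
    exact (Real.sq_sqrt (add_pos h1 h2).le).symm
  set X : Lp ℂ 2 circ := (wspan u (Set.Ici 0)).starProjection (target a f g) with hX
  have hXmem : X ∈ wspan u (Set.Ici 0) := Submodule.starProjection_apply_mem _ _
  set C : ℝ → ℂ := fun θ => X θ * (v θ : ℂ) with hC
  set c : ℕ → ℂ := fun j => ((1 / (2 * Real.pi) : ℝ) : ℂ) * inner ℂ (wex v j) X with hc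
  set e : ℂ := ((1 / (2 * Real.pi) : ℝ) : ℂ) * inner ℂ X (target a f g) with he
  have hCF : IsFourierSum c C := isFourierSum_of_mem_wspan hd hXmem
  have hAm := (memLp_symbolA ha).1
  have hfm : AEStronglyMeasurable (fun θ => (f θ : ℂ)) circ := hfi.ofReal.1
  have hgm : AEStronglyMeasurable (fun θ => (g θ : ℂ)) circ := hgi.ofReal.1
  have htm := memLp_target ha hfi hgi hf hg hmin
  set h₀ : ℝ → ℂ := fun θ => (A θ * f θ - C θ) / (f θ + g θ) with hh₀
  have hm₀ : AEStronglyMeasurable h₀ circ :=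
    (((hAm.mul hfm).sub hCF.1.1).aemeasurable.div (hfm.add hgm).aemeasurable).aestronglyMeasurable
  -- In the weighted space, `h₀` is the residual of the projection of `A f u`.
  have hae : (fun θ => A θ * (f θ * u θ : ℝ) - X θ) =ᵐ[circ] fun θ => h₀ θ * (v θ : ℂ) := by
    filter_upwards [hf, hg, hvv, hd.mul] with θ h1 h2 h3 h4
    have h5 : ((f θ : ℂ) + g θ) ≠ 0 := by exact_mod_cast (add_pos h1 h2).ne'
    simp only [hh₀, hC]
    rw [div_mul_eq_mul_div, eq_div_iff h5, ← h3]
    push_cast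
    linear_combination (A θ * f θ * v θ) * h4
  have hmem₀ : MemLp (fun θ => h₀ θ * (v θ : ℂ)) 2 circ :=
    (memLp_congr_ae hae).1 (htm.sub (Lp.memLp X))
  have hemb₀ : (emb fun θ => h₀ θ * (v θ : ℂ)) = target a f g - X := by
    rw [← emb_congr hae, ← emb_sub htm (Lp.memLp X), emb_coeFn]; rfl
  have hspan : (emb fun θ => h₀ θ * (v θ : ℂ)) ∈ wspan v (Set.Iio 0) := by
    rw [hemb₀]
    exact wspan_orthogonal_le hd (Submodule.sub_starProjection_mem_orthogonal _)
  obtain ⟨p, hpS, hp⟩ := exists_seq_of_mem_wspan hspan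
  obtain ⟨Z, hZ, hZnorm, hZinner⟩ :=
    exists_spectralIntegral hξ hη hind ha hm₀ hmem₀ hp
  -- `A f - h₀ (f + g) = C` has no negative Fourier coefficients, which are exactly the normal
  -- equations.
  have hest : est = Z := optimalEstimate_eq (mem_past_of_tendsto hpS hZ) fun k hk => by
    have h1 := hCF.2.2 k hk
    rw [fourierCoef, mean] at h1
    have hAf : Integrable (fun θ => A θ * (f θ : ℂ)) circ :=
      hfi.ofReal.bdd_mul (c := ∑' j, ‖a j‖) hAm (.of_forall (norm_symbolA_le ha))
    refine (hZinner k).trans ?_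
    rw [← h1]
    congr 1
    rw [← integral_sub (Integrable.mul_ex hAf (-k))]
    · refine integral_congr_ae ?_
      filter_upwards [hf, hg] with θ h2 h3
      have h5 : ((f θ : ℂ) + g θ) ≠ 0 := by exact_mod_cast (add_pos h2 h3).ne'
      simp only [hh₀]
      push_cast
      rw [div_mul_cancel₀ _ h5]; ring
    · refine Integrable.mul_ex ((hAf.sub hCF.1).congr ?_) (-k)
      filter_upwards [hf, hg] with θ h2 h3
      have h5 : ((f θ : ℂ) + g θ) ≠ 0 := by exact_mod_cast (add_pos h2 h3).ne'
      simp only [hh₀, Pi.sub_apply]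
      push_cast
      rw [div_mul_cancel₀ _ h5]
  have hae2 : h₀ =ᵐ[circ] fun θ => A θ - (A θ * g θ + C θ) / (f θ + g θ) := by
    filter_upwards [hf, hg] with θ h2 h3
    have h5 : ((f θ : ℂ) + g θ) ≠ 0 := by exact_mod_cast (add_pos h2 h3).ne'
    simp only [hh₀]
    field_simp
    ring
  have hsf := memLp_sqrt hfi hξ.nonneg
  have hsg := memLp_sqrt hgi hη.nonneg
  have hle_f : ∀ᵐ θ ∂circ, |Real.sqrt (f θ)| ≤ |v θ| := by
    filter_upwards [hg] with θ h1
    rw [abs_of_nonneg (Real.sqrt_nonneg _), abs_of_nonneg (Real.sqrt_nonneg _)]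
    exact Real.sqrt_le_sqrt (by linarith)
  have hle_g : ∀ᵐ θ ∂circ, |Real.sqrt (g θ)| ≤ |v θ| := by
    filter_upwards [hf] with θ h1
    rw [abs_of_nonneg (Real.sqrt_nonneg _), abs_of_nonneg (Real.sqrt_nonneg _)]
    exact Real.sqrt_le_sqrt (by linarith)
  have hAf2 := memLp_mul (memLp_symbolA ha) hsf
  have hhf := memLp_mul_of_le hsf.1 hle_f hm₀ hmem₀
  have hhg := memLp_mul_of_le hsg.1 hle_g hm₀ hmem₀
  have hpt1 : ∀ᵐ θ ∂circ, ‖A θ * (Real.sqrt (f θ) : ℂ) - h₀ θ * (Real.sqrt (f θ) : ℂ)‖ ^ 2 =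
      ‖A θ * g θ + C θ‖ ^ 2 / (f θ + g θ) ^ 2 * f θ := by
    filter_upwards [hf, hg, hae2] with θ h2 h3 h4
    rw [← sub_mul, h4, sub_sub_cancel, norm_mul, norm_div, Complex.norm_real, mul_pow, div_pow,
      Real.norm_of_nonneg (Real.sqrt_nonneg _), Real.sq_sqrt h2.le, ← Complex.ofReal_add,
      Complex.norm_real, Real.norm_of_nonneg (add_pos h2 h3).le]
  have hpt2 : ∀ᵐ θ ∂circ, ‖h₀ θ * (Real.sqrt (g θ) : ℂ)‖ ^ 2 =
      ‖A θ * f θ - C θ‖ ^ 2 / (f θ + g θ) ^ 2 * g θ := by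
    filter_upwards [hf, hg] with θ h2 h3
    rw [norm_mul, norm_div, Complex.norm_real, mul_pow, div_pow,
      Real.norm_of_nonneg (Real.sqrt_nonneg _), Real.sq_sqrt h3.le, ← Complex.ofReal_add,
      Complex.norm_real, Real.norm_of_nonneg (add_pos h2 h3).le]
  have hint1 : Integrable (fun θ => ‖A θ * g θ + C θ‖ ^ 2 / (f θ + g θ) ^ 2 * f θ) circ :=
    ((memLp_two_iff_integrable_sq_norm (hAf2.sub hhf).1).1 (hAf2.sub hhf)).congr hpt1
  have hint2 : Integrable (fun θ => ‖A θ * f θ - C θ‖ ^ 2 / (f θ + g θ) ^ 2 * g θ) circ :=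
    ((memLp_two_iff_integrable_sq_norm hhg.1).1 hhg).congr hpt2
  have herr : ‖Aξ - est‖ ^ 2 =
      1 / (2 * Real.pi) * ∫ θ, ‖A θ * g θ + C θ‖ ^ 2 / (f θ + g θ) ^ 2 * f θ ∂circ +
      1 / (2 * Real.pi) * ∫ θ, ‖A θ * f θ - C θ‖ ^ 2 / (f θ + g θ) ^ 2 * g θ ∂circ := by
    rw [hest, hZnorm, emb_sub hAf2 hhf,
      norm_emb_sq (φ := fun θ => A θ * (Real.sqrt (f θ) : ℂ) - h₀ θ * (Real.sqrt (f θ) : ℂ))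
        (hAf2.sub hhf), norm_emb_sq hhg, mul_add,
      integral_congr_ae hpt1, integral_congr_ae hpt2]
  -- Dominated by `f`.
  have hq : Integrable (fun θ => f θ * g θ / (f θ + g θ)) circ := by
    refine hfi.mono ((hfi.1.aemeasurable.mul hgi.1.aemeasurable).div
      (hfi.1.aemeasurable.add hgi.1.aemeasurable)).aestronglyMeasurable ?_
    filter_upwards [hf, hg] with θ h2 h3
    rw [Real.norm_of_nonneg (by positivity), Real.norm_of_nonneg h2.le,
      div_le_iff₀ (add_pos h2 h3)]
    nlinarith [mul_pos h2 h2]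
  have hpt3 : ∀ᵐ θ ∂circ, ‖X θ‖ ^ 2 = ‖C θ‖ ^ 2 / (f θ + g θ) := by
    filter_upwards [hf, hg, hw] with θ h2 h3 h4
    have h5 : f θ + g θ = v θ ^ 2 := h4
    have h6 := add_pos h2 h3
    rw [hC, eq_div_iff h6.ne', h5, norm_mul, mul_pow, Complex.norm_real, Real.norm_eq_abs, sq_abs]
  -- `Y - X` is orthogonal to `X`, so `⟨X, Y⟩ = ‖X‖²`.
  have heX : e = ((1 / (2 * Real.pi) * ‖X‖ ^ 2 : ℝ) : ℂ) := by
    have h1 : inner ℂ X (target a f g - X) = 0 :=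
      Submodule.sub_starProjection_mem_orthogonal (K := wspan u (Set.Ici 0)) _ _ hXmem
    rw [inner_sub_right, sub_eq_zero, inner_self_eq_norm_sq_to_K] at h1
    rw [he, h1, Complex.ofReal_mul, Complex.ofReal_pow]; rfl
  have hXsq : ‖X‖ ^ 2 = ∫ θ, ‖C θ‖ ^ 2 / (f θ + g θ) ∂circ := by
    rw [← integral_congr_ae hpt3, ← norm_emb_sq (Lp.memLp X), emb_coeFn]
  have hCint : Integrable (fun θ => ‖C θ‖ ^ 2 / (f θ + g θ)) circ :=
    ((memLp_two_iff_integrable_sq_norm (Lp.memLp X).1).1 (Lp.memLp X)).congr hpt3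
  have hAq : Integrable (fun θ => ‖A θ‖ ^ 2 * (f θ * g θ / (f θ + g θ))) circ :=
    hq.bdd_mul (c := (∑' j, ‖a j‖) ^ 2) (hAm.norm.pow 2) (.of_forall fun θ => by
      simpa using pow_le_pow_left₀ (norm_nonneg _) (norm_symbolA_le ha θ) 2)
  have herr2 : ((‖Aξ - est‖ ^ 2 : ℝ) : ℂ) = e + pairing (matVec Q a) a := by
    rw [pairing_toeplitz ha hq, heX, ← Complex.ofReal_add, herr, hXsq, ← mul_add, ← mul_add,
      ← integral_add hint1 hint2, ← integral_add hCint hAq]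
    congr 2
    refine integral_congr_ae ?_
    filter_upwards [hf, hg] with θ h2 h3
    rw [error_identity (A θ) (C θ) h2 h3, add_comm]
  have hRmem := memLp_symbolA_mul_ratio ha hfi hgi hf hg
  -- `R a` consists of Fourier coefficients of the bounded function `A f / (f + g)`, whence its
  -- square summability.
  have hRa : ∀ k : ℕ, Ra k = ((1 / (2 * Real.pi) : ℝ) : ℂ) *
      inner ℂ (wex (fun _ => 1) k)
        (emb fun θ => symbolA a θ * ((f θ / (f θ + g θ) : ℝ) : ℂ)) := fun k => by
    have hi : Integrable (fun θ => f θ / (f θ + g θ)) circ :=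
      ((memLp_two_of_top (memLp_ratio hfi hgi hf hg)).integrable one_le_two).re
    simp only [Ra, R]
    rw [matVec_toeplitz ha hi, inner_wex_emb isDual_one.left _ hRmem]
    simp only [Complex.ofReal_one, mul_one]
  refine ⟨hξ.summable ha, ?_, c, e, C, hG.isInverse hd, fun c' e' h => hG.isInverse_unique hd h,
    hCF, fun C' h => hCF.unique h, fun h => ?_, hae2,
    ⟨hm₀, p, hpS, (tendsto_sqDist_iff hw hd.left hm₀ p).2 ⟨hmem₀, hp⟩⟩, hint1, hint2, herr, herr2,
    fun T hT x hx j => ?_, ?_, fun hc2 => ?_⟩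
  · rw [funext hRa]
    exact memℓp_inner_wex_one _ _
  · rw [hest]
    exact isSpectralIntegral_iff hξ hη hind hf hg hm₀ hmem₀ hp hZ h
  · have := (hG.isInverse_unique hd (isInverse_of_bounded T hT x hx)).1
    exact congrFun this j
  · rintro ⟨K, hK⟩
    -- If `f + g` is bounded then so is `v`; hence `C = X v` is square integrable and Bessel's
    -- inequality applies to `c`.
    have hvt : MemLp (fun θ => (v θ : ℂ)) ∞ circ := by
      refine memLp_top_of_bound hd.left.1 (Real.sqrt K) ?_
      filter_upwards [hK] with θ h1
      rw [Complex.norm_real, Real.norm_of_nonneg (Real.sqrt_nonneg _)]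
      exact Real.sqrt_le_sqrt h1
    have hC2 : MemLp C 2 circ := by
      have := memLp_mul hvt (Lp.memLp X)
      rw [hC]
      simpa only [mul_comm] using this
    have h1 : c = fun j : ℕ => ((1 / (2 * Real.pi) : ℝ) : ℂ) *
        inner ℂ (wex (fun _ => 1) j) (emb C) := by
      ext j
      rw [hc, inner_wex_emb isDual_one.left _ hC2]
      simp only [inner_wex hd.left, Complex.ofReal_one, mul_one, hC]
    rw [h1]
    exact memℓp_inner_wex_one _ _
  · obtain ⟨hC2, hsum⟩ := hCF.hasSum hc2
    constructor
    · have h1 := ((hsum.mapL (innerSL ℂ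
        (emb fun θ => symbolA a θ * ((f θ / (f θ + g θ) : ℝ) : ℂ)))).star).mul_left
        ((1 / (2 * Real.pi) : ℝ) : ℂ)
      simp only [innerSL_apply_apply, RCLike.star_def, inner_conj_symm, inner_smul_left] at h1
      have hfun : (fun k => Ra k * conj (c k)) = fun k : ℕ => ((1 / (2 * Real.pi) : ℝ) : ℂ) *
          (conj (c k) * inner ℂ (wex (fun _ => 1) k)
            (emb fun θ => symbolA a θ * ((f θ / (f θ + g θ) : ℝ) : ℂ))) := by
        ext k
        rw [hRa]; ring
      -- Since `X = C u`, `Y = A f u` and `u² = 1/(f + g)`, one weight can be moved across the inner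
      -- product, leaving an unweighted Parseval pairing.
      have hval : e = ((1 / (2 * Real.pi) : ℝ) : ℂ) * inner ℂ (emb C)
          (emb fun θ => symbolA a θ * ((f θ / (f θ + g θ) : ℝ) : ℂ)) := by
        rw [inner_emb hC2 hRmem, he, ← emb_coeFn X, target, inner_emb (Lp.memLp X) htm]
        congr 1
        refine integral_congr_ae ?_
        filter_upwards [hf, hg, hvv, hd.mul] with θ h2 h3 h4 h5
        have h6 : ((f θ : ℂ) + g θ) ≠ 0 := by exact_mod_cast (add_pos h2 h3).ne'
        simp only [hC, map_mul, Complex.conj_ofReal]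
        push_cast
        have h7 : (u θ : ℂ) = v θ / (f θ + g θ) := by
          rw [eq_div_iff h6, ← h4]
          linear_combination (v θ : ℂ) * h5
        change symbolA a θ * (f θ * (u θ : ℂ)) * _ = _
        rw [h7]; ring
      rw [hfun, hval]
      exact h1
    · have h1 := (tendsto_sqDist_iff (w := fun _ => 1) (v := fun _ => 1) (by simp)
        isDual_one.left hC2.1 (initialPoly c)).2 ⟨by simpa using hC2, by
          simp only [linearCombination_initialPoly, Complex.ofReal_one, mul_one]
          exact hsum.tendsto_sum_nat⟩
      simpa only [trigPoly_initialPoly] using h1
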